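/- **Language.** Types are $\theta ::= \mathsf{unit}\mid\mathsf{int}\mid\theta\times\theta\mid\theta\to\theta$. Method names are typed (infinitely many for each type $\theta\to\theta'$), as are references (integer references, and references to methods of type $\theta\to\theta'$). Values are $v ::= ()\mid i\mid m\mid (v,v)$ with $i\in\mathbb Z$ and $m$ a method name. Terms are built from $()$, integers, the current thread identifier, variables, method names, arithmetic and comparisons, conditionals on integers ($0$ is false), pairs, projections, $\lambda x^\theta.M$, applications $xM$ and $mM$, $\mathsf{let}\ x=M\ \mathsf{in}\ N$, $r:=M$, $!r$, and the lock operations $\mathit{acquire}$ and $\mathit{release}$. A lock is an integer reference; $\mathit{acquire}$ is an atomic step that is enabled only when its content is $0$ (free) and sets it to $1$, and $\mathit{release}$ sets it to $0$. A library $L:\Theta\to\Theta'$ declares abstract methods $\Theta$ and public methods $\Theta'$, implements the latter, and initialises references with integers or functions. Terms are reduced by a left-to-right call-by-value small-step semantics over a repository $\mathcal R$ of methods and a store $S$; evaluating $\lambda x.M$ adds a fresh method name to $\mathcal R$. **Histories.** A move $(t,x)_{XY}$ consists of a thread identifier $t$, a call or return $x\in\{\mathsf{call}\,m(v),\mathsf{ret}\,m(v)\}$,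 a player $X\in\{O,P\}$ (environment, library) and a side $Y\in\{\mathcal K,\mathcal L\}$ (client, parameter library). Prehistories are the words of the grammars $H_X ::= \epsilon\mid \mathsf{call}\,m(v)_{XY}\,H_{X'}\,\mathsf{ret}\,m(v')_{X'Y}\,H_X$ with $X'\neq X$ and $v,v'$ of the argument and result types of $m$. A history over $\Theta\to\Theta'$ is an interleaving of prehistories in $H_O$ tagged with threads $1,\dots,N$ ($N>0$) such that (1) for every move $(t,\mathsf{call}\,m(v))_{XY}$, either $m\in\Theta'$ and $XY=O\mathcal K$, or $m\in\Theta$ and $XY=P\mathcal L$, or $m$ occurs in the value of an earlier move of the other player on side $Y$; (2) every method name in the value of a move does not occur in any earlier move. A history is sequential if it has the form $(t_1,x_1)_O(t_1,x_1')_P\cdots(t_k,x_k)_O(t_k,x_k')_P$. For histories, $h\lhd h'$ means that $h'$ arises from $h$ by swapping two adjacent moves of different threads of which the first is an $O$-move or the second is a $P$-move; $h'$ linearises $h$ if $h\lhd^* h'$ (through histories). **Semantics.** $[\![L]\!]_N$ is the set of move sequences of runs of $N$ concurrent threads from the initial configuration (empty evaluation stacks, no active terms, repository and store produced by $L$) to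 a final one (all evaluation stacks empty and no work pending). In a run each thread reduces internally, the environment calls methods that are public or were passed to it, the library calls methods that are abstract or were passed to it, and both return from pending calls, with values of the right type. Method names passed by the library are replaced by fresh names bound to their eta-expansions. Method names passed by the environment are fresh, i.e. neither previously exchanged or declared nor in the repository; internally created names are likewise fresh. $L:\Theta\to\Theta'$ *linearises* to a set $A$ of sequential histories over $\Theta\to\Theta'$ if for every $N>0$ and every $h\in[\![L]\!]_N$ there is $h'\in A$ that linearises $h$. **The library.** $L_{\sf mset}:\emptyset\to\Theta$, with $\Theta=\{\mathit{count}:\mathsf{int}\to\mathsf{int},\ \mathit{update}:\mathsf{int}\times(\mathsf{int}\to\mathsf{int})\to\mathsf{int}\}$, has a lock $\mathit{lock}$ (initially free), a private reference $F:=\lambda x.0$, the public methods $$\mathit{count}=\lambda i.\,(!F)\,i,\qquad \mathit{update}=\lambda(i,g).\,\mathit{upd\_r}(i,g,(!F)\,i),$$ and the private method (stored in a private reference) $$\begin{aligned}\mathit{upd\_r}=\lambda(i,g,j).\ &\mathsf{let}\ y=|g\,j|\ \mathsf{in}\ \mathit{lock.acquire}();\ \mathsf{let}\ f=\,!F\ \mathsf{in}\\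 &\mathsf{if}\ j=f\,i\ \mathsf{then}\ \{F:=\lambda x.\,\mathsf{if}\ x=i\ \mathsf{then}\ y\ \mathsf{else}\ f\,x;\ \mathit{lock.release}();\ y\}\\ &\mathsf{else}\ \{\mathit{lock.release}();\ \mathit{upd\_r}(i,g,f\,i)\}.\end{aligned}$$ **The specification.** For a finite multiset $I$ of integers let $I(i)$ be the multiplicity of $i$ and $I[i\mapsto n]$ be $I$ with the multiplicity of $i$ set to $n$. $A_{\sf mset}$ is the set of sequential histories $h$ over $\emptyset\to\Theta$ for which one can attach to each move a finite multiset of integers such that the first move (if any) carries the empty multiset, each $P$-move and an immediately following $O$-move carry the same multiset, and, for each thread $t$, the subsequence of the moves of $t$ is generated from $\mathcal S$ by the grammar (all moves on side $\mathcal K$; $i,j,j'$ range over integers, $I,J,J'$ over multisets, $m$ over method names) $$\begin{aligned}\mathcal S\ \to\ &\epsilon\ \mid\ (t,\mathsf{call}\,\mathit{count}(i),I)_O\,(t,\mathsf{ret}\,\mathit{count}(I(i)),I)_P\,\mathcal S\\ \mid\ &(t,\mathsf{call}\,\mathit{update}(i,m),I)_O\ \mathcal M^{m,i,j}_{I,J}\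 (t,\mathsf{ret}\,\mathit{update}(|j|),J[i\mapsto|j|])_P\ \mathcal S,\\ \mathcal M^{m,i,j}_{I,J}\ \to\ &(t,\mathsf{call}\,m(I(i)),I)_P\ \mathcal S\ (t,\mathsf{ret}\,m(j),J)_O\quad\text{if } I(i)=J(i),\\ \mathcal M^{m,i,j}_{I,J}\ \to\ &(t,\mathsf{call}\,m(I(i)),I)_P\ \mathcal S\ (t,\mathsf{ret}\,m(j'),J')_O\ \mathcal M^{m,i,j}_{J',J}\quad\text{if } I(i)\ne J'(i).\end{aligned}$$ **Lemma (Multiset).** $L_{\sf mset}$ is a well-typed library over $\emptyset\to\Theta$, every element of $A_{\sf mset}$ is a sequential history over $\emptyset\to\Theta$, and $L_{\sf mset}$ linearises to $A_{\sf mset}$. -/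

import Mathlib

namespace HOLin

/-! ## Types, names, values -/

/-- Types `θ ::= unit | int | θ × θ | θ → θ`. -/
inductive Ty where
  | unit
  | int
  | prod (a b : Ty)
  | arr (a b : Ty)
  deriving DecidableEq

/-- Method names.  Names are typed: those with `dom = θ`, `cod = θ'` form the (infinite) set
`Meths_{θ,θ'}`. -/
structure Meth where
  dom : Ty
  cod : Ty
  id : ℕ
  deriving DecidableEq

/-- Reference names: integer references, and references to methods of type `θ → θ'`. -/
inductive Ref where
  | int (id : ℕ)
  | fn (a b : Ty) (id : ℕ)
  deriving DecidableEq

abbrev Var := ℕ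

/-- The type of the contents of a reference. -/
def Ref.ty : Ref → Ty
  | .int _ => .int
  | .fn a b _ => .arr a b

/-- Values `v ::= () | i | m | (v, v)`. -/
inductive Val where
  | unit
  | int (i : ℤ)
  | meth (m : Meth)
  | pair (v w : Val)

namespace Val

/-- The method names contained in a value. -/
def names : Val → Set Meth
  | unit => ∅
  | int _ => ∅
  | meth m => {m}
  | pair v w => v.names ∪ w.names

/-- Renaming of the method names of a value. -/
def rename (σ : Meth → Meth) : Val → Val
  | unit => unit
  | int i => int i
  | meth m => meth (σ m)
  | pair v w => pair (v.rename σ) (w.rename σ)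

inductive HasType : Val → Ty → Prop
  | unit : HasType unit .unit
  | int (i : ℤ) : HasType (int i) .int
  | meth (m : Meth) : HasType (meth m) (.arr m.dom m.cod)
  | pair {v w : Val} {a b : Ty} : HasType v a → HasType w b → HasType (pair v w) (.prod a b)

end Val

/-! ## Histories -/

/-- The two players: `O` (the environment) and `P` (the library). -/
inductive Player where
  | O
  | P
  deriving DecidableEq

def Player.opp : Player → Player
  | .O => .P
  | .P => .O

/-- The side of an interaction: `K` (with the client) or `L` (with the parameter library). -/
inductive Side where
  | K
  | L
  deriving DecidableEq

inductive Action where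
  | call (m : Meth) (v : Val)
  | ret (m : Meth) (v : Val)

namespace Action

def meth : Action → Meth
  | call m _ => m
  | ret m _ => m

def val : Action → Val
  | call _ v => v
  | ret _ v => v

end Action

/-- A call or return decorated with its polarity `XY`. -/
structure PMove where
  act : Action
  player : Player
  side : Side

/-- A move `(t, x)_{XY}`: a decorated call or return tagged with a thread identifier. -/
structure Move extends PMove where
  tid : ℕ

/-- Prehistories: `PreHist .O` and `PreHist .P` are the languages of the two grammars
`H_X ::= ε | call m(v)_{XY} H_{X'} ret m(v')_{X'Y} H_X`, with `X'` the opponent of `X`. -/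
inductive PreHist : Player → List PMove → Prop
  | nil (X : Player) : PreHist X []
  | cons (X : Player) (Y : Side) (m : Meth) (v w : Val) (h k : List PMove) :
      v.HasType m.dom → w.HasType m.cod → PreHist X.opp h → PreHist X k →
      PreHist X (⟨.call m v, X, Y⟩ :: (h ++ ⟨.ret m w, X.opp, Y⟩ :: k))

/-- The moves of thread `t` in `h`, without their thread identifier. -/
def threadProj (t : ℕ) (h : List Move) : List PMove :=
  (h.filter (fun x => x.tid = t)).map Move.toPMove

/-- Every called method is public and called by the client, or abstract and called by the library
on the parameter library, or was introduced in an earlier move of the other player on the same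
side. -/
def CallsIntroduced (Θ Θ' : Set Meth) (h : List Move) : Prop :=
  ∀ (s₁ s₂ : List Move) (x : Move) (m : Meth) (v : Val),
    h = s₁ ++ x :: s₂ → x.act = .call m v →
      (m ∈ Θ' ∧ x.player = .O ∧ x.side = .K) ∨
      (m ∈ Θ ∧ x.player = .P ∧ x.side = .L) ∨
      ∃ y ∈ s₁, y.player ≠ x.player ∧ y.side = x.side ∧ m ∈ y.act.val.names

/-- Every method name contained in the value of a move does not occur in any earlier move. -/
def NamesFresh (h : List Move) : Prop :=
  ∀ (s₁ s₂ : List Move) (x : Move), h = s₁ ++ x :: s₂ →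
    ∀ m ∈ x.act.val.names, ∀ y ∈ s₁, m ≠ y.act.meth ∧ m ∉ y.act.val.names

/-- The histories over `Θ → Θ'`: interleavings of `N > 0` prehistories of the environment, with
thread identifiers `1, …, N`, that satisfy the two conditions on names. -/
def Hist (Θ Θ' : Set Meth) : Set (List Move) :=
  {h | (∃ N : ℕ, 0 < N ∧ (∀ x ∈ h, 1 ≤ x.tid ∧ x.tid ≤ N) ∧
          ∀ t, 1 ≤ t → t ≤ N → PreHist .O (threadProj t h)) ∧
        CallsIntroduced Θ Θ' h ∧ NamesFresh h}

/-- The shape `(t₁,x₁)_O (t₁,x₁')_P ⋯ (tₖ,xₖ)_O (tₖ,xₖ')_P`. -/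
def Sequential : List Move → Prop
  | [] => True
  | [_] => False
  | x :: y :: s => x.tid = y.tid ∧ x.player = .O ∧ y.player = .P ∧ Sequential s

/-- The sequential histories over `Θ → Θ'`. -/
def SeqHist (Θ Θ' : Set Meth) : Set (List Move) :=
  {h | h ∈ Hist Θ Θ' ∧ Sequential h}

/-- The reordering relation on histories that swaps two adjacent moves of different
threads, where the first is an `X'`-move or the second is an `X`-move. -/
def Swap (Θ Θ' : Set Meth) (X X' : Player) (h k : List Move) : Prop :=
  h ∈ Hist Θ Θ' ∧ k ∈ Hist Θ Θ' ∧
  ∃ (s₁ s₂ : List Move) (x y : Move), x.tid ≠ y.tid ∧ (x.player = X' ∨ y.player = X) ∧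
    h = s₁ ++ x :: y :: s₂ ∧ k = s₁ ++ y :: x :: s₂

/-- `h` is linearised by `k`. -/
def LinearisedBy (Θ Θ' : Set Meth) (h k : List Move) : Prop :=
  h ∈ Hist Θ Θ' ∧ k ∈ Hist Θ Θ' ∧ Relation.ReflTransGen (Swap Θ Θ' .P .O) h k

/-! ## Syntax and typing of terms and libraries -/

/-- Arithmetic operations; comparisons return `1` or `0`. -/
inductive BinOp where
  | add
  | sub
  | mul
  | eq
  | lt

def BinOp.eval : BinOp → ℤ → ℤ → ℤ
  | .add, i, j => i + j
  | .sub, i, j => i - j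
  | .mul, i, j => i * j
  | .eq, i, j => if i = j then 1 else 0
  | .lt, i, j => if i < j then 1 else 0

/-- Terms.  An application `app M N` is well typed only if `M` is a variable or a method name.
`acquire r` is the atomic acquisition of a lock, which is an integer reference with contents `0`
when the lock is free. -/
inductive Term where
  | unit
  | int (i : ℤ)
  | tid
  | var (x : Var)
  | meth (m : Meth)
  | op (o : BinOp) (M N : Term)
  | ite (M N₁ N₀ : Term)
  | pair (M N : Term)
  | fst (M : Term)
  | snd (M : Term)
  | lam (x : Var) (θ : Ty) (M : Term)
  | app (M N : Term)
  | letIn (x : Var) (M N : Term)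
  | assign (r : Ref) (M : Term)
  | deref (r : Ref)
  | acquire (r : Ref)

def Val.toTerm : Val → Term
  | .unit => .unit
  | .int i => .int i
  | .meth m => .meth m
  | .pair v w => .pair v.toTerm w.toTerm

namespace Term

/-- Releasing a lock. -/
def release (r : Ref) : Term := assign r (int 0)

/-- The substitution `M{v/x}`; capture cannot occur, as values have no variables. -/
def subst (x : Var) (v : Val) : Term → Term
  | unit => unit
  | int i => int i
  | tid => tid
  | var y => if y = x then v.toTerm else var y
  | meth m => meth m
  | op o M N => op o (M.subst x v) (N.subst x v)
  | ite M N₁ N₀ => ite (M.subst x v) (N₁.subst x v) (N₀.subst x v)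
  | pair M N => pair (M.subst x v) (N.subst x v)
  | fst M => fst (M.subst x v)
  | snd M => snd (M.subst x v)
  | lam y θ M => lam y θ (if y = x then M else M.subst x v)
  | app M N => app (M.subst x v) (N.subst x v)
  | letIn y M N => letIn y (M.subst x v) (if y = x then N else N.subst x v)
  | assign r M => assign r (M.subst x v)
  | deref r => deref r
  | acquire r => acquire r

/-- The method names occurring in a term. -/
def names : Term → Set Meth
  | unit => ∅
  | int _ => ∅
  | tid => ∅
  | var _ => ∅
  | meth m => {m}
  | op _ M N => M.names ∪ N.names
  | ite M N₁ N₀ => M.names ∪ N₁.names ∪ N₀.names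
  | pair M N => M.names ∪ N.names
  | fst M => M.names
  | snd M => M.names
  | lam _ _ M => M.names
  | app M N => M.names ∪ N.names
  | letIn _ M N => M.names ∪ N.names
  | assign _ M => M.names
  | deref _ => ∅
  | acquire _ => ∅

end Term

/-- Typing environments. -/
abbrev Ctx := Var → Option Ty

def Ctx.empty : Ctx := fun _ => none

def Ctx.extend (Γ : Ctx) (x : Var) (θ : Ty) : Ctx := Function.update Γ x (some θ)

inductive Term.HasType : Ctx → Term → Ty → Prop
  | unit {Γ} : HasType Γ .unit .unit
  | int {Γ} (i : ℤ) : HasType Γ (.int i) .int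
  | tid {Γ} : HasType Γ .tid .int
  | var {Γ : Ctx} {x θ} : Γ x = some θ → HasType Γ (.var x) θ
  | meth {Γ} (m : Meth) : HasType Γ (.meth m) (.arr m.dom m.cod)
  | op {Γ M N} (o : BinOp) : HasType Γ M .int → HasType Γ N .int → HasType Γ (.op o M N) .int
  | ite {Γ M N₁ N₀ θ} : HasType Γ M .int → HasType Γ N₁ θ → HasType Γ N₀ θ →
      HasType Γ (.ite M N₁ N₀) θ
  | pair {Γ M N a b} : HasType Γ M a → HasType Γ N b → HasType Γ (.pair M N) (.prod a b)
  | fst {Γ M a b} : HasType Γ M (.prod a b) → HasType Γ (.fst M) a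
  | snd {Γ M a b} : HasType Γ M (.prod a b) → HasType Γ (.snd M) b
  | lam {Γ M x a b} : HasType (Γ.extend x a) M b → HasType Γ (.lam x a M) (.arr a b)
  | appVar {Γ : Ctx} {x M a b} : Γ x = some (.arr a b) → HasType Γ M a →
      HasType Γ (.app (.var x) M) b
  | appMeth {Γ M} (m : Meth) : HasType Γ M m.dom → HasType Γ (.app (.meth m) M) m.cod
  | letIn {Γ x M N a b} : HasType Γ M a → HasType (Γ.extend x a) N b →
      HasType Γ (.letIn x M N) b
  | assign {Γ M} (r : Ref) : HasType Γ M r.ty → HasType Γ (.assign r M) .unit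
  | deref {Γ} (r : Ref) : HasType Γ (.deref r) r.ty
  | acquire {Γ} (n : ℕ) : HasType Γ (.acquire (.int n)) .unit

/-- Blocks `B ::= ε | m = λx.M; B | r := λx.M; B | r := i; B`, where `r` is a reference to methods
of type `a → b` in the third form and an integer reference in the last one. -/
inductive Block where
  | nil
  | defMeth (m : Meth) (x : Var) (M : Term) (B : Block)
  | initFn (a b : Ty) (n : ℕ) (x : Var) (M : Term) (B : Block)
  | initInt (n : ℕ) (i : ℤ) (B : Block)

/-- Libraries `L ::= B | abstract m; L | public m; L`. -/
inductive Library where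
  | block (B : Block)
  | abstr (m : Meth) (L : Library)
  | pub (m : Meth) (L : Library)

/-- The method names occurring in a block. -/
def Block.names : Block → Set Meth
  | nil => ∅
  | defMeth m _ M B => {m} ∪ M.names ∪ B.names
  | initFn _ _ _ _ M B => M.names ∪ B.names
  | initInt _ _ B => B.names

/-- The method names occurring in a library. -/
def Library.names : Library → Set Meth
  | block B => B.names
  | abstr m L => {m} ∪ L.names
  | pub m L => {m} ∪ L.names

/-- `B.HasType Θ`: the block `B` is well typed and defines the methods of `Θ`. -/
inductive Block.HasType : Block → Set Meth → Prop
  | nil : HasType .nil ∅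
  | defMeth {m x M B Θ} : Term.HasType (Ctx.empty.extend x m.dom) M m.cod → HasType B Θ → m ∉ Θ →
      HasType (.defMeth m x M B) (insert m Θ)
  | initFn {a b n x M B Θ} : Term.HasType (Ctx.empty.extend x a) M b → HasType B Θ →
      HasType (.initFn a b n x M B) Θ
  | initInt {n i B Θ} : HasType B Θ → HasType (.initInt n i B) Θ

/-- `HasType Θ L Θ' Θ''` is the judgement `Θ ⊢ L : Θ' → Θ''`; in particular, `HasType ∅ L Θ Θ'`
says that `L` is a library with abstract methods `Θ` and public methods `Θ'`. -/
inductive Library.HasType : Set Meth → Library → Set Meth → Set Meth → Prop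
  | block {B Θ} : B.HasType Θ → HasType B.names (.block B) ∅ Θ
  | pub {m L Θ Θ' Θ''} : m ∉ Θ → HasType (insert m Θ) L Θ' Θ'' → m ∈ Θ'' →
      HasType Θ (.pub m L) Θ' Θ''
  | abstr {m L Θ Θ' Θ''} : m ∉ Θ → HasType (insert m Θ) L Θ' Θ'' → m ∉ Θ'' → m ∉ Θ' →
      HasType Θ (.abstr m L) (insert m Θ') Θ''

/-! ## Operational semantics -/

/-- A function `λx.M`. -/
structure Abs where
  x : Var
  body : Term

/-- Own-method repositories. -/
abbrev Repo := Meth → Option Abs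

/-- Stores. -/
abbrev Store := Ref → Option Val

/-- Evaluation of a library declaration or block entry.  The names in `used` are those that may
not be chosen as fresh names. -/
inductive LibStep (used : Set Meth) :
    Library × Repo × Store → Library × Repo × Store → Prop
  | abstr (m L R S) : LibStep used (.abstr m L, R, S) (L, R, S)
  | pub (m L R S) : LibStep used (.pub m L, R, S) (L, R, S)
  | initInt (n i B R S) : LibStep used (.block (.initInt n i B), R, S)
      (.block B, R, Function.update S (.int n) (some (.int i)))
  | defMeth (m x M B) (R : Repo) (S) : R m = none →
      LibStep used (.block (.defMeth m x M B), R, S)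
        (.block B, Function.update R m (some ⟨x, M⟩), S)
  | initFn (m : Meth) (a b n x M B) (R : Repo) (S) : m.dom = a → m.cod = b → R m = none →
      m ∉ used →
      LibStep used (.block (.initFn a b n x M B), R, S)
        (.block B, Function.update R m (some ⟨x, M⟩),
          Function.update S (.fn a b n) (some (.meth m)))

/-- The library `L` evaluates to the initial repository `R` and the initial store `S`. -/
def Library.EvalsTo (L : Library) (R : Repo) (S : Store) : Prop :=
  Relation.ReflTransGen (LibStep L.names) (L, fun _ => none, fun _ => none) (.block .nil, R, S)

/-- Evaluation contexts. -/
inductive ECtx where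
  | hole
  | opL (o : BinOp) (E : ECtx) (M : Term)
  | opR (o : BinOp) (i : ℤ) (E : ECtx)
  | ite (E : ECtx) (N₁ N₀ : Term)
  | fst (E : ECtx)
  | snd (E : ECtx)
  | pairL (E : ECtx) (M : Term)
  | pairR (v : Val) (E : ECtx)
  | app (m : Meth) (E : ECtx)
  | letIn (x : Var) (E : ECtx) (M : Term)
  | assign (r : Ref) (E : ECtx)

namespace ECtx

/-- `E.fill M` is `E[M]`. -/
def fill : ECtx → Term → Term
  | hole, T => T
  | opL o E M, T => .op o (E.fill T) M
  | opR o i E, T => .op o (.int i) (E.fill T)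
  | ite E N₁ N₀, T => .ite (E.fill T) N₁ N₀
  | fst E, T => .fst (E.fill T)
  | snd E, T => .snd (E.fill T)
  | pairL E M, T => .pair (E.fill T) M
  | pairR v E, T => .pair v.toTerm (E.fill T)
  | app m E, T => .app (.meth m) (E.fill T)
  | letIn x E M, T => .letIn x (E.fill T) M
  | assign r E, T => .assign r (E.fill T)

/-- The method names occurring in an evaluation context. -/
def names (E : ECtx) : Set Meth := (E.fill .unit).names

end ECtx

/-- Reduction of closed terms in thread `t`. -/
inductive TStep (t : ℕ) : Term × Repo × Store → Term × Repo × Store → Prop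
  | tid (E : ECtx) (R S) : TStep t (E.fill .tid, R, S) (E.fill (.int t), R, S)
  | op (E : ECtx) (o : BinOp) (i j : ℤ) (R S) :
      TStep t (E.fill (.op o (.int i) (.int j)), R, S) (E.fill (.int (o.eval i j)), R, S)
  | deref (E : ECtx) (r : Ref) (v : Val) (R) (S : Store) : S r = some v →
      TStep t (E.fill (.deref r), R, S) (E.fill v.toTerm, R, S)
  | iteFalse (E : ECtx) (N₁ N₀ : Term) (R S) :
      TStep t (E.fill (.ite (.int 0) N₁ N₀), R, S) (E.fill N₀, R, S)
  | iteTrue (E : ECtx) (i : ℤ) (N₁ N₀ : Term) (R S) : i ≠ 0 →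
      TStep t (E.fill (.ite (.int i) N₁ N₀), R, S) (E.fill N₁, R, S)
  | assign (E : ECtx) (r : Ref) (v : Val) (R S) :
      TStep t (E.fill (.assign r v.toTerm), R, S)
        (E.fill .unit, R, Function.update S r (some v))
  | acquire (E : ECtx) (r : Ref) (R) (S : Store) : S r = some (.int 0) →
      TStep t (E.fill (.acquire r), R, S)
        (E.fill .unit, R, Function.update S r (some (.int 1)))
  | lam (E : ECtx) (x : Var) (θ : Ty) (M : Term) (m : Meth) (R : Repo) (S) :
      m.dom = θ → Term.HasType (Ctx.empty.extend x θ) M m.cod → R m = none →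
      TStep t (E.fill (.lam x θ M), R, S)
        (E.fill (.meth m), Function.update R m (some ⟨x, M⟩), S)
  | app (E : ECtx) (m : Meth) (v : Val) (x : Var) (M : Term) (R : Repo) (S) :
      R m = some ⟨x, M⟩ →
      TStep t (E.fill (.app (.meth m) v.toTerm), R, S) (E.fill (M.subst x v), R, S)
  | fst (E : ECtx) (v w : Val) (R S) :
      TStep t (E.fill (.fst (.pair v.toTerm w.toTerm)), R, S) (E.fill v.toTerm, R, S)
  | snd (E : ECtx) (v w : Val) (R S) :
      TStep t (E.fill (.snd (.pair v.toTerm w.toTerm)), R, S) (E.fill w.toTerm, R, S)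
  | letIn (E : ECtx) (x : Var) (v : Val) (M : Term) (R S) :
      TStep t (E.fill (.letIn x v.toTerm M), R, S) (E.fill (M.subst x v), R, S)

/-! ## Trace semantics -/

inductive StackItem where
  | ctx (E : ECtx)
  | meth (m : Meth)

def StackItem.names : StackItem → Set Meth
  | ctx E => E.names
  | meth m => {m}

/-- The component `(ℰ, X)` of a thread: an evaluation stack and a term, where `focus = none`
stands for the mark `-` of an `O`-configuration. -/
structure Thread where
  stack : List StackItem
  focus : Option Term

/-- The method names occurring in a thread. -/
def Thread.names (C : Thread) : Set Meth :=
  {m | (∃ X ∈ C.stack, m ∈ X.names) ∨ ∃ M ∈ C.focus, m ∈ M.names}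

/-- The shared components `(ℛ, 𝒫, 𝒜, S)` of a configuration. -/
structure Env where
  repo : Repo
  pub : Side → Set Meth
  abs : Side → Set Meth
  store : Store

/-- Names fresh for `𝒫, 𝒜` and the repository. -/
def Env.Fresh (e : Env) (m : Meth) : Prop :=
  (∀ Y, m ∉ e.pub Y ∧ m ∉ e.abs Y) ∧ e.repo m = none

/-- `𝒫 ∪_Y Z`. -/
def addNames (P : Side → Set Meth) (Y : Side) (Z : Set Meth) : Side → Set Meth :=
  Function.update P Y (P Y ∪ Z)

/-- The library passes `v` to side `Y`: each name in `v` is replaced by a fresh name, which is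
made public and mapped to the eta-expansion of the original one.  The passed value is `v'`. -/
def Publish (e : Env) (Y : Side) (v v' : Val) (e' : Env) : Prop :=
  ∃ σ : Meth → Meth, Set.InjOn σ v.names ∧
    (∀ m ∈ v.names, e.Fresh (σ m) ∧ (σ m).dom = m.dom ∧ (σ m).cod = m.cod) ∧
    v' = v.rename σ ∧
    (∀ m ∈ v.names, e'.repo (σ m) = some ⟨0, .app (.meth m) (.var 0)⟩) ∧
    (∀ n, n ∉ σ '' v.names → e'.repo n = e.repo n) ∧
    e'.pub = addNames e.pub Y (σ '' v.names) ∧ e'.abs = e.abs ∧ e'.store = e.store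

/-- The environment passes `v` to the library from side `Y`: the names in `v` have to be fresh
and become abstract methods. -/
def Receive (e : Env) (Y : Side) (v : Val) (e' : Env) : Prop :=
  (∀ m ∈ v.names, e.Fresh m) ∧ e' = { e with abs := addNames e.abs Y v.names }

/-- Internal steps of thread `t`. -/
inductive IntStep (t : ℕ) : Thread → Env → Thread → Env → Prop
  | mk (St : List StackItem) (M M' : Term) (e : Env) (R' : Repo) (S' : Store) :
      TStep t (M, e.repo, e.store) (M', R', S') →
      (∀ m, e.repo m = none → R' m ≠ none →
        (∀ X ∈ St, m ∉ X.names) ∧ ∀ Y, m ∉ e.abs Y) →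
      IntStep t ⟨St, some M⟩ e ⟨St, some M'⟩ { e with repo := R', store := S' }

/-- External steps: calls and returns of `P` and of `O`. -/
inductive ExtStep : Thread → Env → PMove → Thread → Env → Prop
  | callP (Y : Side) (St : List StackItem) (E : ECtx) (m : Meth) (v v' : Val) (e e' : Env) :
      m ∈ e.abs Y → v.HasType m.dom → Publish e Y v v' e' →
      ExtStep ⟨St, some (E.fill (.app (.meth m) v.toTerm))⟩ e ⟨.call m v', .P, Y⟩
        ⟨.meth m :: .ctx E :: St, none⟩ e'
  | retP (Y : Side) (St : List StackItem) (m : Meth) (v v' : Val) (e e' : Env) :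
      m ∈ e.pub Y → v.HasType m.cod → Publish e Y v v' e' →
      ExtStep ⟨.meth m :: St, some v.toTerm⟩ e ⟨.ret m v', .P, Y⟩ ⟨St, none⟩ e'
  | callO (Y : Side) (St : List StackItem) (m : Meth) (x : Var) (M : Term) (v : Val)
      (e e' : Env) :
      m ∈ e.pub Y → e.repo m = some ⟨x, M⟩ → v.HasType m.dom → Receive e Y v e' →
      ExtStep ⟨St, none⟩ e ⟨.call m v, .O, Y⟩ ⟨.meth m :: St, some (M.subst x v)⟩ e'
  | retO (Y : Side) (St : List StackItem) (E : ECtx) (m : Meth) (v : Val) (e e' : Env) :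
      m ∈ e.abs Y → v.HasType m.cod → Receive e Y v e' →
      ExtStep ⟨.meth m :: .ctx E :: St, none⟩ e ⟨.ret m v, .O, Y⟩
        ⟨St, some (E.fill v.toTerm)⟩ e'

/-- `N`-configurations `(C₁ ‖ ⋯ ‖ C_N, ℛ, 𝒫, 𝒜, S)`; thread `i : Fin N` has the identifier
`i + 1`. -/
structure NConf (N : ℕ) where
  threads : Fin N → Thread
  env : Env

/-- Final configurations: each component is `([], -)` or `([], ())`. -/
def NConf.Final {N : ℕ} (ρ : NConf N) : Prop :=
  ∀ i, (ρ.threads i).stack = [] ∧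
    ((ρ.threads i).focus = none ∨ (ρ.threads i).focus = some .unit)

/-- `Trace ρ s ρ'`: the moves produced by some run from `ρ` to `ρ'` are `s`. -/
inductive Trace {N : ℕ} : NConf N → List Move → NConf N → Prop
  | refl (ρ : NConf N) : Trace ρ [] ρ
  | int (ρ ρ' : NConf N) (s : List Move) (i : Fin N) (C : Thread) (e : Env) :
      IntStep (i + 1) (ρ.threads i) ρ.env C e →
      (∀ m, ρ.env.repo m = none → e.repo m ≠ none → ∀ k, m ∉ (ρ.threads k).names) →
      Trace ⟨Function.update ρ.threads i C, e⟩ s ρ' → Trace ρ s ρ'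
  | ext (ρ ρ' : NConf N) (s : List Move) (i : Fin N) (x : PMove) (C : Thread) (e : Env) :
      ExtStep (ρ.threads i) ρ.env x C e →
      Trace ⟨Function.update ρ.threads i C, e⟩ s ρ' → Trace ρ (⟨x, i + 1⟩ :: s) ρ'

/-- The initial `N`-configuration of a library over `Θ → Θ'`. -/
def initConf (N : ℕ) (Θ Θ' : Set Meth) (R : Repo) (S : Store) : NConf N where
  threads := fun _ => ⟨[], none⟩
  env :=
    { repo := R
      pub := fun | .L => ∅ | .K => Θ'
      abs := fun | .L => Θ | .K => ∅
      store := S }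

/-- The `N`-trace semantics of a library over `Θ → Θ'`. -/
def semN (N : ℕ) (Θ Θ' : Set Meth) (L : Library) : Set (List Move) :=
  {s | ∃ R S, L.EvalsTo R S ∧ ∃ ρ, Trace (initConf N Θ Θ' R S) s ρ ∧ ρ.Final}

/-- General linearisability: `L : Θ → Θ'` can be linearised to the set `A`. -/
def GenLinearises (Θ Θ' : Set Meth) (L : Library) (A : Set (List Move)) : Prop :=
  ∀ N : ℕ, 0 < N → ∀ h ∈ semN N Θ Θ' L, ∃ h' ∈ A, LinearisedBy Θ Θ' h h'

/-! ## The multiset library -/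

namespace MSet

/-- `count : int → int`. -/
def count : Meth := ⟨.int, .int, 0⟩

/-- `update : int × (int → int) → int`. -/
def update : Meth := ⟨.prod .int (.arr .int .int), .int, 0⟩

/-- The public methods. -/
def methods : Set Meth := {count, update}

/-- The argument type `int × ((int → int) × int)` of the private method `upd_r`. -/
def updRDom : Ty := .prod .int (.prod (.arr .int .int) .int)

def lockRef : Ref := .int 0

/-- The private reference `F : int → int`. -/
def fRef : Ref := .fn .int .int 0

/-- The private reference holding `upd_r`. -/
def updRRef : Ref := .fn updRDom .int 0

/-- `M; N`, for `N` in which the variable `100` is not free. -/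
def seq (M N : Term) : Term := .letIn 100 M N

/-- `(!r) M`, where the variable `101` is not free in `M`. -/
def callRef (r : Ref) (M : Term) : Term := .letIn 101 (.deref r) (.app (.var 101) M)

/-- `|M|`. -/
def absTerm (M : Term) : Term :=
  .letIn 102 M (.ite (.op .lt (.var 102) (.int 0)) (.op .sub (.int 0) (.var 102)) (.var 102))

abbrev vp : Var := 0
abbrev vi : Var := 1
abbrev vg : Var := 2
abbrev vj : Var := 3
abbrev vy : Var := 4
abbrev vf : Var := 5
abbrev vx : Var := 6

/-- `count = λi. (!F) i`. -/
def countBody : Term := callRef fRef (.var vi)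

/-- `update = λ(i, g). upd_r(i, g, (!F) i)`; the argument is the variable `p`. -/
def updateBody : Term :=
  .letIn vi (.fst (.var vp)) <|
  .letIn vg (.snd (.var vp)) <|
  callRef updRRef (.pair (.var vi) (.pair (.var vg) (callRef fRef (.var vi))))

/-- The body of
`upd_r = λ(i, g, j). let y = |g j| in lock.acquire(); let f = !F in
  if (j == f i) then { F := λx. if (x == i) then y else f x; lock.release(); y }
  else { lock.release(); upd_r(i, g, f i) }`;
the argument `(i, (g, j))` is the variable `p`. -/
def updRBody : Term :=
  .letIn vi (.fst (.var vp)) <|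
  .letIn vg (.fst (.snd (.var vp))) <|
  .letIn vj (.snd (.snd (.var vp))) <|
  .letIn vy (absTerm (.app (.var vg) (.var vj))) <|
  seq (.acquire lockRef) <|
  .letIn vf (.deref fRef) <|
  .ite (.op .eq (.var vj) (.app (.var vf) (.var vi)))
    (seq (.assign fRef (.lam vx .int
        (.ite (.op .eq (.var vx) (.var vi)) (.var vy) (.app (.var vf) (.var vx))))) <|
      seq (.release lockRef) <|
      .var vy)
    (seq (.release lockRef) <|
      callRef updRRef (.pair (.var vi) (.pair (.var vg) (.app (.var vf) (.var vi)))))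

/-- The multiset library. -/
def lib : Library :=
  .pub count <|
  .pub update <|
  .block <|
  .initInt 0 0 <|
  .initFn .int .int 0 vx (.int 0) <|
  .defMeth count vi countBody <|
  .defMeth update vp updateBody <|
  .initFn updRDom .int 0 vp updRBody <|
  .nil

/-! ## The sequential specification -/

/-- `I[i ↦ n]`: the multiset `I` with the multiplicity of `i` set to `n`. -/
def setMult (I : Multiset ℤ) (i : ℤ) (n : ℕ) : Multiset ℤ :=
  I.filter (fun k => k ≠ i) + Multiset.replicate n i

/-- Moves accompanied by a multiset. -/
abbrev ExtMove := Move × Multiset ℤ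

/-- `(t, call m(v), I)_{XK}`. -/
def callMove (t : ℕ) (X : Player) (m : Meth) (v : Val) (I : Multiset ℤ) : ExtMove :=
  (⟨⟨.call m v, X, .K⟩, t⟩, I)

/-- `(t, ret m(v), I)_{XK}`. -/
def retMove (t : ℕ) (X : Player) (m : Meth) (v : Val) (I : Multiset ℤ) : ExtMove :=
  (⟨⟨.ret m v, X, .K⟩, t⟩, I)

mutual

/-- The grammar `𝒮` for thread `t`. -/
inductive SpecS (t : ℕ) : List ExtMove → Prop
  | nil : SpecS t []
  | count (i : ℤ) (I : Multiset ℤ) (s : List ExtMove) : SpecS t s →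
      SpecS t (callMove t .O count (.int i) I ::
        retMove t .P count (.int (I.count i)) I :: s)
  | update (i j : ℤ) (m : Meth) (I J : Multiset ℤ) (s u : List ExtMove) :
      SpecM t m i j I J u → SpecS t s →
      SpecS t (callMove t .O update (.pair (.int i) (.meth m)) I ::
        (u ++ retMove t .P update (.int |j|) (setMult J i j.natAbs) :: s))

/-- The grammar `ℳ_{I,J}^{i,j}` for thread `t` and the method `m` passed to `update`. -/
inductive SpecM (t : ℕ) : Meth → ℤ → ℤ → Multiset ℤ → Multiset ℤ → List ExtMove → Prop
  | done (m : Meth) (i j : ℤ) (I J : Multiset ℤ) (s : List ExtMove) :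
      I.count i = J.count i → SpecS t s →
      SpecM t m i j I J (callMove t .P m (.int (I.count i)) I ::
        (s ++ [retMove t .O m (.int j) J]))
  | retry (m : Meth) (i j j' : ℤ) (I J J' : Multiset ℤ) (s u : List ExtMove) :
      I.count i ≠ J'.count i → SpecS t s → SpecM t m i j J' J u →
      SpecM t m i j I J (callMove t .P m (.int (I.count i)) I ::
        (s ++ retMove t .O m (.int j') J' :: u))

end

/-- The extended histories of the specification: the multiset is empty at the start, it is not
changed by `O`, and each thread follows the grammar. -/
def specExt : Set (List ExtMove) :=
  {s | s.map Prod.fst ∈ SeqHist ∅ methods ∧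
    (∀ x ∈ s.head?, x.2 = 0) ∧
    (∀ (s₁ s₂ : List ExtMove) (x y : ExtMove), s = s₁ ++ x :: y :: s₂ →
      x.1.player = .P → y.1.player = .O → x.2 = y.2) ∧
    ∀ t, SpecS t (s.filter (fun x => x.1.tid = t))}

/-- The sequential specification of the multiset library. -/
def spec : Set (List Move) := {h | ∃ s ∈ specExt, h = s.map Prod.fst}

end MSet

end HOLin

/-!
Each `O`-move of a thread is followed in that thread by a `P`-move, and between the two the library
passes one *linearisation point*, at which the current abstract multiset, together with the
`O`-move and the pending calls of the thread, determines the coming `P`-move: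

* for `count (i)` and for the first call of `g` in `update (i, g)`, the reading of `F`;
* after `g` has returned `j` to an `update (i, g)` that had called it with argument `I₀(i)`: the
  assignment to `F` if the multiplicity of `i` is unchanged, which sets it to `|j|`, and otherwise
  the reading of `F` under the lock, which determines the argument of the next call of `g`.

Between the reading of `F` under the lock and the assignment no other thread changes `F`, so the
comparison and the update are atomic. The contents of `F` are chains of closures, each overriding
the next in one point; a closure never changes once it exists, so its application, which
may last arbitrarily long, yields the value that was current when `F` was read (`Represents`).

Listing the pairs of an `O`-move and its `P`-move in the order of their linearisation points gives
a sequential history. It arises from the original history by moving `O`-moves to the right and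
`P`-moves to the left, since the linearisation point lies between the two moves of a pair. The
intermediate lists are histories because every name that the library calls was introduced in the
same thread, and the order of the moves of each thread never changes (`Good`).

`AbsTrace` describes runs of an abstract system whose threads only play moves and pass
linearisation points. `Simulates.trace` matches runs of the library by abstract runs. To keep the
number of program points small it uses that reduction of a thread is deterministic and
independent of the other threads except at the accesses to `F`, the accesses to the lock and the
creation of closures: a thread is described by the next such point that it reaches by local steps
(`AtPoint`, `TStep.eq_of_lstep`). `AbsTrace.remaining`, `AbsTrace.reorders` and
`AbsTrace.exists_spec` are the combinatorial half: the linearised list obeys the grammar of the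
specification in each thread, and the played moves can be reordered to it.
-/

namespace HOLin

/-! ### Unique decomposition and deterministic local steps -/

/-- The value denoted by a term, if the term is a value. -/
def Term.toVal? : Term → Option Val
  | .unit => some .unit
  | .int i => some (.int i)
  | .meth m => some (.meth m)
  | .pair M N =>
    match M.toVal?, N.toVal? with
    | some v, some w => some (.pair v w)
    | _, _ => none
  | _ => none

@[simp] theorem Term.toVal?_toTerm (v : Val) : v.toTerm.toVal? = some v := by
  induction v <;> simp_all [Val.toTerm, Term.toVal?]

theorem Term.toVal?_fill {T : Term} (h : T.toVal? = none) (E : ECtx) :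
    (E.fill T).toVal? = none := by
  induction E <;> simp_all [ECtx.fill, Term.toVal?]

theorem Term.ne_int_of_toVal? {T : Term} (h : T.toVal? = none) (i : ℤ) : T ≠ .int i := by
  rintro rfl
  simp [Term.toVal?] at h

/-- Composition of evaluation contexts: `(E.comp E').fill M = E.fill (E'.fill M)`. -/
def ECtx.comp : ECtx → ECtx → ECtx
  | .hole, D => D
  | .opL o E M, D => .opL o (E.comp D) M
  | .opR o i E, D => .opR o i (E.comp D)
  | .ite E M N, D => .ite (E.comp D) M N
  | .fst E, D => .fst (E.comp D)
  | .snd E, D => .snd (E.comp D)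
  | .pairL E M, D => .pairL (E.comp D) M
  | .pairR v E, D => .pairR v (E.comp D)
  | .app m E, D => .app m (E.comp D)
  | .letIn x E M, D => .letIn x (E.comp D) M
  | .assign r E, D => .assign r (E.comp D)

theorem ECtx.fill_comp (E D : ECtx) (M : Term) : (E.comp D).fill M = E.fill (D.fill M) := by
  induction E <;> simp_all [ECtx.fill, ECtx.comp]

@[simp] theorem ECtx.comp_hole (E : ECtx) : E.comp .hole = E := by
  induction E <;> simp_all [ECtx.comp]

/-- Left-to-right search for the redex of a term and the evaluation context around it. -/
def decomp : Term → Option (ECtx × Term)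
  | .op o M N =>
    match M with
    | .int i =>
      match N with
      | .int j => some (.hole, .op o (.int i) (.int j))
      | N => (decomp N).map fun p => (.opR o i p.1, p.2)
    | M => (decomp M).map fun p => (.opL o p.1 N, p.2)
  | .ite M N₁ N₀ =>
    match M.toVal? with
    | some _ => some (.hole, .ite M N₁ N₀)
    | none => (decomp M).map fun p => (.ite p.1 N₁ N₀, p.2)
  | .fst M =>
    match M.toVal? with
    | some _ => some (.hole, .fst M)
    | none => (decomp M).map fun p => (.fst p.1, p.2)
  | .snd M =>
    match M.toVal? with
    | some _ => some (.hole, .snd M)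
    | none => (decomp M).map fun p => (.snd p.1, p.2)
  | .pair M N =>
    match M.toVal? with
    | some v => (decomp N).map fun p => (.pairR v p.1, p.2)
    | none => (decomp M).map fun p => (.pairL p.1 N, p.2)
  | .app F M =>
    match F with
    | .meth m =>
      match M.toVal? with
      | some _ => some (.hole, .app (.meth m) M)
      | none => (decomp M).map fun p => (.app m p.1, p.2)
    | _ => none
  | .letIn x M N =>
    match M.toVal? with
    | some _ => some (.hole, .letIn x M N)
    | none => (decomp M).map fun p => (.letIn x p.1 N, p.2)
  | .assign r M =>
    match M.toVal? with
    | some _ => some (.hole, .assign r M)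
    | none => (decomp M).map fun p => (.assign r p.1, p.2)
  | .lam x θ M => some (.hole, .lam x θ M)
  | .deref r => some (.hole, .deref r)
  | .acquire r => some (.hole, .acquire r)
  | .tid => some (.hole, .tid)
  | .unit => none
  | .int _ => none
  | .var _ => none
  | .meth _ => none

@[simp] theorem decomp_toTerm (v : Val) : decomp v.toTerm = none := by
  induction v <;> simp_all [Val.toTerm, decomp]

theorem Term.eq_toTerm_of_toVal? {M : Term} {v : Val} (h : M.toVal? = some v) :
    M = v.toTerm := by
  induction M generalizing v with
  | pair M N ihM ihN =>
    simp only [Term.toVal?] at h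
    split at h
    · rename_i v w hv hw
      cases h
      simp [Val.toTerm, ← ihM hv, ← ihN hw]
    · simp at h
  | _ => simp_all [Term.toVal?] <;> (subst h; rfl)

theorem toVal?_of_decomp {M : Term} {p : ECtx × Term} (h : decomp M = some p) :
    M.toVal? = none := by
  cases hv : M.toVal? with
  | none => rfl
  | some v => simp [Term.eq_toTerm_of_toVal? hv] at h

/-- The search for a redex commutes with filling a context. -/
theorem decomp_fill {M : Term} {D : ECtx} {r : Term} (h : decomp M = some (D, r)) (E : ECtx) :
    decomp (E.fill M) = some (E.comp D, r) := by
  have hv := toVal?_of_decomp h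
  induction E with
  | hole => exact h
  | opL o E N ih =>
    have := Term.ne_int_of_toVal? (Term.toVal?_fill hv E)
    simp only [ECtx.fill, ECtx.comp]
    generalize E.fill M = T at *
    cases T <;> simp_all [decomp]
  | opR o i E ih =>
    have := Term.ne_int_of_toVal? (Term.toVal?_fill hv E)
    simp only [ECtx.fill, ECtx.comp]
    generalize E.fill M = T at *
    cases T <;> simp_all [decomp]
  | _ => simp_all [ECtx.fill, ECtx.comp, decomp, Term.toVal?_fill hv]

/-- Reduction of redexes, i.e. `TStep` with the evaluation context removed. -/
inductive RStep (t : ℕ) : Term → Repo → Store → Term → Repo → Store → Prop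
  | tid (R S) : RStep t .tid R S (.int t) R S
  | op (o : BinOp) (i j : ℤ) (R S) :
      RStep t (.op o (.int i) (.int j)) R S (.int (o.eval i j)) R S
  | deref (r : Ref) (v : Val) (R) (S : Store) : S r = some v →
      RStep t (.deref r) R S v.toTerm R S
  | ite (i : ℤ) (N₁ N₀ : Term) (R S) :
      RStep t (.ite (.int i) N₁ N₀) R S (if i = 0 then N₀ else N₁) R S
  | assign (r : Ref) (M : Term) (v : Val) (R S) : M.toVal? = some v →
      RStep t (.assign r M) R S .unit R (Function.update S r (some v))
  | acquire (r : Ref) (R) (S : Store) : S r = some (.int 0) →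
      RStep t (.acquire r) R S .unit R (Function.update S r (some (.int 1)))
  | lam (x : Var) (θ : Ty) (M : Term) (m : Meth) (R : Repo) (S) : R m = none →
      RStep t (.lam x θ M) R S (.meth m) (Function.update R m (some ⟨x, M⟩)) S
  | app (m : Meth) (N : Term) (v : Val) (x : Var) (M : Term) (R : Repo) (S) :
      R m = some ⟨x, M⟩ → N.toVal? = some v →
      RStep t (.app (.meth m) N) R S (M.subst x v) R S
  | fst (M N : Term) (v w : Val) (R S) : M.toVal? = some v → N.toVal? = some w →
      RStep t (.fst (.pair M N)) R S M R S
  | snd (M N : Term) (v w : Val) (R S) : M.toVal? = some v → N.toVal? = some w →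
      RStep t (.snd (.pair M N)) R S N R S
  | letIn (x : Var) (N : Term) (v : Val) (M : Term) (R S) : N.toVal? = some v →
      RStep t (.letIn x N M) R S (M.subst x v) R S

theorem RStep.decomp_eq {t : ℕ} {r r' : Term} {R R' : Repo} {S S' : Store}
    (h : RStep t r R S r' R' S') : decomp r = some (.hole, r) := by
  cases h <;> simp_all [decomp, Term.toVal?]

theorem TStep.exists_rstep {t : ℕ} {M M' : Term} {R R' : Repo} {S S' : Store}
    (h : TStep t (M, R, S) (M', R', S')) :
    ∃ E r r', decomp M = some (E, r) ∧ M' = E.fill r' ∧ RStep t r R S r' R' S' := by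
  have key : ∀ {E : ECtx} {r r' : Term}, RStep t r R S r' R' S' → M = E.fill r → M' = E.fill r' →
      ∃ E r r', decomp M = some (E, r) ∧ M' = E.fill r' ∧ RStep t r R S r' R' S' := by
    rintro E r r' hr rfl rfl
    exact ⟨E, r, r', by simpa using decomp_fill hr.decomp_eq E, rfl, hr⟩
  cases h with
  | tid E => exact key (.tid _ _) rfl rfl
  | op E o i j => exact key (.op o i j _ _) rfl rfl
  | deref E r v _ _ h => exact key (.deref r v _ _ h) rfl rfl
  | iteFalse E N₁ N₀ => exact key (.ite 0 N₁ N₀ _ _) rfl (by simp)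
  | iteTrue E i N₁ N₀ _ _ h => exact key (.ite i N₁ N₀ _ _) rfl (by simp [h])
  | assign E r v => exact key (.assign r _ v _ _ (by simp)) rfl rfl
  | acquire E r _ _ h => exact key (.acquire r _ _ h) rfl rfl
  | lam E x θ M m _ _ _ _ h => exact key (.lam x θ M m _ _ h) rfl rfl
  | app E m v x M _ _ h => exact key (.app m _ v x M _ _ h (by simp)) rfl rfl
  | fst E v w => exact key (.fst _ _ v w _ _ (by simp) (by simp)) rfl rfl
  | snd E v w => exact key (.snd _ _ v w _ _ (by simp) (by simp)) rfl rfl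
  | letIn E x v M => exact key (.letIn x _ v M _ _ (by simp)) rfl rfl

theorem TStep.rstep_of_decomp {t : ℕ} {M M' : Term} {R R' : Repo} {S S' : Store}
    {E : ECtx} {r : Term} (h : TStep t (M, R, S) (M', R', S')) (hd : decomp M = some (E, r)) :
    ∃ r', M' = E.fill r' ∧ RStep t r R S r' R' S' := by
  obtain ⟨E', r₀, r', hd', rfl, hr⟩ := h.exists_rstep
  rw [hd] at hd'
  cases hd'
  exact ⟨r', rfl, hr⟩

/-- Contraction of the redexes that only read the repository, together with the dereferencing of
one reference `ref` whose content `m₀` is constant. -/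
def contract (R : Repo) (ref : Ref) (m₀ : Meth) : Term → Option Term
  | .op o (.int i) (.int j) => some (.int (o.eval i j))
  | .ite (.int i) N₁ N₀ => some (if i = 0 then N₀ else N₁)
  | .fst (.pair M _) => some M
  | .snd (.pair _ N) => some N
  | .letIn x M N => M.toVal?.map fun v => N.subst x v
  | .app (.meth m) M => (R m).bind fun a => M.toVal?.map fun v => a.body.subst a.x v
  | .deref r => if r = ref then some (.meth m₀) else none
  | _ => none

/-- The deterministic reduction of a term by one step of `contract`. -/
def lstep (R : Repo) (ref : Ref) (m₀ : Meth) (M : Term) : Option Term :=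
  (decomp M).bind fun p => (contract R ref m₀ p.2).map p.1.fill

/-- Reduction by local steps. -/
def LSteps (R : Repo) (ref : Ref) (m₀ : Meth) : Term → Term → Prop :=
  Relation.ReflTransGen fun M M' => lstep R ref m₀ M = some M'

theorem LSteps.head {R : Repo} {ref : Ref} {m₀ : Meth} {M M' M'' : Term}
    (h : lstep R ref m₀ M = some M') (h' : LSteps R ref m₀ M' M'') : LSteps R ref m₀ M M'' :=
  Relation.ReflTransGen.head h h'

/-- When a local step is possible, it is the only step of the thread. -/
theorem TStep.eq_of_lstep {t : ℕ} {M M' M₁ : Term} {R R' : Repo} {S S' : Store} {ref : Ref}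
    {m₀ : Meth} (h : TStep t (M, R, S) (M', R', S')) (hl : lstep R ref m₀ M = some M₁)
    (hS : S ref = some (.meth m₀)) : M' = M₁ ∧ R' = R ∧ S' = S := by
  obtain ⟨E, r, r', hd, rfl, hr⟩ := h.exists_rstep
  simp only [lstep, hd, Option.bind_some, Option.map_eq_some_iff] at hl
  obtain ⟨r₁, hc, rfl⟩ := hl
  cases hr <;> simp_all [contract]
  case deref v hv =>
    obtain ⟨-, rfl⟩ := hc
    simp [← hv, Val.toTerm]

theorem lstep_mono {R R' : Repo} {ref : Ref} {m₀ : Meth} {M M' : Term}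
    (hR : ∀ m a, R m = some a → R' m = some a) (h : lstep R ref m₀ M = some M') :
    lstep R' ref m₀ M = some M' := by
  simp only [lstep, Option.bind_eq_some_iff, Option.map_eq_some_iff] at h ⊢
  obtain ⟨⟨E, r⟩, hd, r', hc, rfl⟩ := h
  refine ⟨(E, r), hd, r', ?_, rfl⟩
  unfold contract at hc ⊢
  split at hc
  case h_6 =>
    simp only [Option.bind_eq_some_iff] at hc ⊢
    obtain ⟨a, ha, hc⟩ := hc
    exact ⟨a, hR _ _ ha, hc⟩
  all_goals simp_all

theorem LSteps.mono {R R' : Repo} {ref : Ref} {m₀ : Meth} {M M' : Term}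
    (hR : ∀ m a, R m = some a → R' m = some a) (h : LSteps R ref m₀ M M') :
    LSteps R' ref m₀ M M' := by
  induction h with
  | refl => exact .refl
  | tail _ h ih => exact .tail ih (lstep_mono hR h)

theorem lstep_fill {R : Repo} {ref : Ref} {m₀ : Meth} {M M' : Term}
    (h : lstep R ref m₀ M = some M') (E : ECtx) :
    lstep R ref m₀ (E.fill M) = some (E.fill M') := by
  simp only [lstep, Option.bind_eq_some_iff, Option.map_eq_some_iff] at h ⊢
  obtain ⟨⟨D, r⟩, hd, r', hc, rfl⟩ := h
  exact ⟨_, decomp_fill hd E, r', hc, by simp [ECtx.fill_comp]⟩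

theorem LSteps.fill {R : Repo} {ref : Ref} {m₀ : Meth} {M M' : Term}
    (h : LSteps R ref m₀ M M') (E : ECtx) : LSteps R ref m₀ (E.fill M) (E.fill M') := by
  induction h with
  | refl => exact .refl
  | tail _ h ih => exact .tail ih (lstep_fill h E)

theorem LSteps.eq_of_lstep_eq_none {R : Repo} {ref : Ref} {m₀ : Meth} {M M' : Term}
    (h : LSteps R ref m₀ M M') (hM : lstep R ref m₀ M = none) : M = M' := by
  obtain rfl | ⟨_, h, _⟩ := h.cases_head
  · rfl
  · simp [hM] at h

namespace MSet

/-! ### The abstract transition system -/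

/-- A pending call of a function `g` that was passed to `update (i, g)`; the multiset `I` is the
one at the linearisation point of the call, so that the argument of `g` is `I(i)`. -/
structure Frame where
  g : Meth
  i : ℤ
  I : Multiset ℤ

/-- The status of a thread between an `O`-move and the next `P`-move of the thread: `called x`
means that the `O`-move `x` has been played and awaits its linearisation point, `lined y` that the
linearisation point is past and has determined the next `P`-move `y`. -/
inductive Status where
  | idle
  | called (x : PMove)
  | lined (y : PMove)

/-- `LinStep I st x J y st'`: at a linearisation point with current multiset `I`, a thread with
pending calls `st` answers the `O`-move `x` by the `P`-move `y`; the multiset becomes `J` and the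
pending calls become `st'`. -/
inductive LinStep : Multiset ℤ → List Frame → PMove → Multiset ℤ → PMove → List Frame → Prop
  | count (i : ℤ) (I st) : LinStep I st ⟨.call count (.int i), .O, .K⟩
      I ⟨.ret count (.int (I.count i)), .P, .K⟩ st
  | update (i : ℤ) (g : Meth) (I st) : g.dom = .int → g.cod = .int →
      LinStep I st ⟨.call update (.pair (.int i) (.meth g)), .O, .K⟩
        I ⟨.call g (.int (I.count i)), .P, .K⟩ (⟨g, i, I⟩ :: st)
  | retry (i j : ℤ) (g : Meth) (I₀ I st) : g.dom = .int → g.cod = .int →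
      I₀.count i ≠ I.count i →
      LinStep I (⟨g, i, I₀⟩ :: st) ⟨.ret g (.int j), .O, .K⟩
        I ⟨.call g (.int (I.count i)), .P, .K⟩ (⟨g, i, I⟩ :: st)
  | done (i j : ℤ) (g : Meth) (I₀ I st) : g.dom = .int → g.cod = .int →
      I₀.count i = I.count i →
      LinStep I (⟨g, i, I₀⟩ :: st) ⟨.ret g (.int j), .O, .K⟩
        (setMult I i j.natAbs) ⟨.ret update (.int |j|), .P, .K⟩ st

/-- Runs of `N` threads in which each `O`-move is followed by a linearisation point and then by
the `P`-move determined there.  In `AbsTrace σ I A h s`, the current state is given by the pending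
calls and status `σ k` of each thread `k`, the multiset `I` and the set `A` of names introduced so
far; `h` lists the moves still to be played and `s` the pairs of moves, in the order of their
linearisation points, still to be linearised. -/
inductive AbsTrace {N : ℕ} : (Fin N → List Frame × Status) → Multiset ℤ → Set Meth →
    List Move → List ExtMove → Prop
  | nil (σ I A) : (∀ k, σ k = ([], .idle)) → AbsTrace σ I A [] []
  | opp (σ I A h s) (k : Fin N) (st : List Frame) (x : PMove) : σ k = (st, .idle) →
      x.player = .O → (∀ m ∈ x.act.val.names, m ∉ A ∧ m ∉ methods) →
      AbsTrace (Function.update σ k (st, .called x)) I (A ∪ x.act.val.names) h s →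
      AbsTrace σ I A (⟨x, k + 1⟩ :: h) s
  | lin (σ I A h s) (k : Fin N) (st st' : List Frame) (x y : PMove) (J : Multiset ℤ) :
      σ k = (st, .called x) → LinStep I st x J y st' →
      AbsTrace (Function.update σ k (st', .lined y)) J A h s →
      AbsTrace σ I A h ((⟨x, k + 1⟩, I) :: (⟨y, k + 1⟩, J) :: s)
  | prop (σ I A h s) (k : Fin N) (st : List Frame) (y : PMove) : σ k = (st, .lined y) →
      y.act.val.names = ∅ → AbsTrace (Function.update σ k (st, .idle)) I A h s →
      AbsTrace σ I A (⟨y, k + 1⟩ :: h) s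

/-! ### The linearised history satisfies the specification -/

/-- The moves of an extended history without thread identifiers and multisets. -/
def toPMoves (s : List ExtMove) : List PMove := s.map fun x => x.1.toPMove

/-- What remains to be played by thread `t` with pending calls `st`: for each pending call the
rest of a word of `ℳ` whose first call has been played, and then the return of `update`. -/
def Remaining (t : ℕ) : List Frame → List ExtMove → Prop
  | [], s => SpecS t s ∧ PreHist .O (toPMoves s)
  | f :: st, s => ∃ (u s' : List ExtMove) (j : ℤ) (J : Multiset ℤ),
      s = u ++ retMove t .P update (.int |j|) (setMult J f.i j.natAbs) :: s' ∧
      SpecM t f.g f.i j f.I J (callMove t .P f.g (.int (f.I.count f.i)) f.I :: u) ∧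
      PreHist .P (toPMoves (callMove t .P f.g (.int (f.I.count f.i)) f.I :: u)) ∧
      Remaining t st s'

/-- Complete words of `𝒮` may be played whatever calls are pending. -/
theorem Remaining.append {t : ℕ} {e : List ExtMove} (he : ∀ s, SpecS t s → SpecS t (e ++ s))
    (hp : ∀ k, PreHist .O k → PreHist .O (toPMoves e ++ k)) {st : List Frame}
    {s : List ExtMove} (h : Remaining t st s) : Remaining t st (e ++ s) := by
  cases st with
  | nil => exact ⟨he s h.1, by simpa [toPMoves] using hp _ h.2⟩
  | cons f st =>
    obtain ⟨u, s', j, J, rfl, hM, hP, hR⟩ := h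
    refine ⟨e ++ u, s', j, J, by simp, ?_, ?_, hR⟩
    · generalize hc : callMove t .P f.g (.int (f.I.count f.i)) f.I :: u = w at hM
      cases hM with
      | done _ _ _ _ _ s₀ h₁ h₂ =>
        obtain ⟨-, rfl⟩ := List.cons.inj hc
        simpa using SpecM.done f.g f.i j f.I J (e ++ s₀) h₁ (he _ h₂)
      | retry _ _ _ j' _ _ J' s₀ u' h₁ h₂ h₃ =>
        obtain ⟨-, rfl⟩ := List.cons.inj hc
        simpa using SpecM.retry f.g f.i j j' f.I J J' (e ++ s₀) u' h₁ (he _ h₂) h₃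
    · generalize hw : toPMoves (callMove t .P f.g (.int (f.I.count f.i)) f.I :: u) = w at hP
      cases hP with
      | nil => simp [toPMoves] at hw
      | cons _ Y m v w h k hv hw' hh hk =>
        simp only [toPMoves, List.map_cons, List.cons.injEq] at hw
        have := PreHist.cons .P Y m v w (toPMoves e ++ h) k hv hw' (hp _ hh) hk
        simpa [toPMoves, hw] using this

theorem Remaining.linStep {t : ℕ} {I J : Multiset ℤ} {st st' : List Frame} {x y : PMove}
    {s : List ExtMove} (hs : Remaining t st' s) (h : LinStep I st x J y st') :
    Remaining t st ((⟨x, t⟩, I) :: (⟨y, t⟩, J) :: s) := by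
  cases h with
  | count i =>
    refine Remaining.append (e := [_, _]) (fun s hs => .count i I s hs) (fun k hk => ?_) hs
    exact .cons .O .K count (.int i) (.int (I.count i)) [] k (.int _) (.int _) (.nil _) hk
  | update i g _ _ hd hc =>
    obtain ⟨u, s', j, K, rfl, hM, hP, hR⟩ := hs
    have := Remaining.append
      (e := callMove t .O update (.pair (.int i) (.meth g)) I ::
        ((callMove t .P g (.int (I.count i)) I :: u) ++
          [retMove t .P update (.int |j|) (setMult K i j.natAbs)]))
      (fun s hs => by simpa using SpecS.update i j g I K s _ hM hs) (fun k hk => ?_) hR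
    · simpa [callMove] using this
    · have hg : Val.HasType (.pair (.int i) (.meth g)) update.dom := by
        have := Val.HasType.meth g
        rw [hd, hc] at this
        exact .pair (.int _) this
      simpa [toPMoves, callMove, retMove, Player.opp] using
        PreHist.cons .O .K update _ (.int |j|) _ k hg (.int _) hP hk
  | retry i j g I₀ _ st hd hc hne =>
    obtain ⟨u, s', j', K, rfl, hM, hP, hR⟩ := hs
    refine ⟨_ :: _ :: u, s', j', K, rfl, SpecM.retry g i j' j I₀ K I [] _ hne .nil hM, ?_, hR⟩
    exact .cons .P .K g (.int _) (.int j) [] _ (hd ▸ .int _) (hc ▸ .int _) (.nil _) hP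
  | done i j g I₀ _ st hd hc he =>
    refine ⟨[_], s, j, I, rfl, SpecM.done g i j I₀ I [] he .nil, ?_, hs⟩
    exact .cons .P .K g (.int _) (.int j) [] _ (hd ▸ .int _) (hc ▸ .int _) (.nil _) (.nil _)

theorem filter_tid_cons_self {t : ℕ} (x y : PMove) (I J : Multiset ℤ) (s : List ExtMove) :
    ((⟨x, t⟩, I) :: (⟨y, t⟩, J) :: s : List ExtMove).filter (fun z => z.1.tid = t) =
      (⟨x, t⟩, I) :: (⟨y, t⟩, J) :: s.filter (fun z => z.1.tid = t) := by
  simp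

theorem filter_tid_cons_ne {t t' : ℕ} (h : t' ≠ t) (x y : PMove) (I J : Multiset ℤ)
    (s : List ExtMove) :
    ((⟨x, t'⟩, I) :: (⟨y, t'⟩, J) :: s : List ExtMove).filter (fun z => z.1.tid = t) =
      s.filter (fun z => z.1.tid = t) := by
  simp [h]

theorem AbsTrace.remaining {N : ℕ} {σ : Fin N → List Frame × Status} {I A h s}
    (H : AbsTrace σ I A h s) (l : Fin N) :
    Remaining (l + 1) (σ l).1 (s.filter fun z => z.1.tid = l + 1) := by
  induction H with
  | nil σ I A hσ => simpa [hσ, Remaining, toPMoves] using ⟨SpecS.nil, PreHist.nil .O⟩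
  | opp σ I A h s k st x hk _ _ _ ih =>
    by_cases hl : l = k
    · subst hl; simpa [hk] using ih
    · simpa [Function.update_of_ne hl] using ih
  | lin σ I A h s k st st' x y J hk hL _ ih =>
    by_cases hl : l = k
    · subst hl
      rw [filter_tid_cons_self, hk]
      exact Remaining.linStep (by simpa using ih) hL
    · rw [filter_tid_cons_ne (by simpa [Fin.val_inj] using Ne.symm hl)]
      simpa [Function.update_of_ne hl] using ih
  | prop σ I A h s k st x hk _ _ ih =>
    by_cases hl : l = k
    · subst hl; simpa [hk] using ih
    · simpa [Function.update_of_ne hl] using ih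

theorem LinStep.players {I J : Multiset ℤ} {st st' : List Frame} {x y : PMove}
    (h : LinStep I st x J y st') : x.player = .O ∧ y.player = .P := by
  cases h <;> simp

/-- `s` consists of `O`-`P`-pairs of moves of one thread, where the multiset of each `O`-move is
that of the preceding move, and `I` at the start. -/
def Chained : Multiset ℤ → List ExtMove → Prop
  | _, [] => True
  | _, [_] => False
  | I, x :: y :: s => x.2 = I ∧ x.1.tid = y.1.tid ∧ x.1.player = .O ∧ y.1.player = .P ∧
      Chained y.2 s

theorem AbsTrace.chained {N : ℕ} {σ : Fin N → List Frame × Status} {I A h s}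
    (H : AbsTrace σ I A h s) : Chained I s := by
  induction H with
  | nil => trivial
  | opp => assumption
  | lin _ _ _ _ _ _ _ _ _ _ _ _ hL _ ih => exact ⟨rfl, rfl, hL.players.1, hL.players.2, ih⟩
  | prop => assumption

theorem Chained.sequential : ∀ {I : Multiset ℤ} {s : List ExtMove}, Chained I s →
    Sequential (s.map Prod.fst)
  | _, [], _ => trivial
  | _, [_], h => h.elim
  | _, _ :: _ :: _, ⟨_, h₁, h₂, h₃, h⟩ => ⟨h₁, h₂, h₃, h.sequential⟩

theorem Chained.head {I : Multiset ℤ} {s : List ExtMove} (h : Chained I s) :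
    ∀ x ∈ s.head?, x.2 = I := by
  match s, h with
  | [], _ => simp
  | _ :: _ :: _, h => simpa using h.1

theorem Chained.adjacent : ∀ {I : Multiset ℤ} {s : List ExtMove}, Chained I s →
    ∀ (s₁ s₂ : List ExtMove) (x y : ExtMove), s = s₁ ++ x :: y :: s₂ →
      x.1.player = .P → y.1.player = .O → x.2 = y.2
  | _, [], _, s₁, _, _, _, e, _, _ => by simp at e
  | _, [_], h, _, _, _, _, _, _, _ => h.elim
  | _, a :: b :: s, ⟨_, _, ha, hb, h⟩, s₁, s₂, x, y, e, hx, hy => by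
    match s₁, e with
    | [], e =>
      obtain ⟨rfl, -⟩ := List.cons.inj e
      simp [ha] at hx
    | [_], e =>
      simp only [List.cons_append, List.nil_append, List.cons.injEq] at e
      obtain ⟨rfl, rfl, rfl⟩ := e
      exact (h.head y (by simp)).symm
    | _ :: _ :: s₁, e =>
      simp only [List.cons_append, List.cons.injEq] at e
      exact h.adjacent s₁ s₂ x y e.2.2 hx hy

/-! ### Introduction and freshness of names -/

/-- The names that `x` makes available for calls by the library. -/
def introduced (x : PMove) : Set Meth := {m | x.player = .O ∧ x.side = .K ∧ m ∈ x.act.val.names}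

/-- A move of a public method, called by the environment only, or of a method in `Z`, called by
the library only. -/
def Admissible (Z : Set Meth) (x : PMove) : Prop :=
  x.side = .K ∧
    ((x.act.meth ∈ methods ∧ ∀ m v, x.act = .call m v → x.player = .O) ∨
      (x.act.meth ∈ Z ∧ ∀ m v, x.act = .call m v → x.player = .P))

/-- All methods of the moves in the list are public, in `Z`, or introduced earlier in the list. -/
def Introducing : Set Meth → List PMove → Prop
  | _, [] => True
  | Z, x :: p => Admissible Z x ∧ Introducing (Z ∪ introduced x) p

theorem Admissible.mono {Z Z' : Set Meth} (h : Z ⊆ Z') {x : PMove} (hx : Admissible Z x) :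
    Admissible Z' x :=
  ⟨hx.1, hx.2.imp id fun h' => ⟨h h'.1, h'.2⟩⟩

theorem Introducing.mono {p : List PMove} : ∀ {Z Z' : Set Meth}, Z ⊆ Z' → Introducing Z p →
    Introducing Z' p := by
  induction p with
  | nil => intros; trivial
  | cons x p ih =>
    intro Z Z' h hp
    exact ⟨hp.1.mono h, ih (Set.union_subset_union_left _ h) hp.2⟩

theorem Introducing.admissible {x : PMove} {p₂ : List PMove} : ∀ {p₁ : List PMove} {Z : Set Meth},
    Introducing Z (p₁ ++ x :: p₂) → Admissible (Z ∪ {m | ∃ y ∈ p₁, m ∈ introduced y}) x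
  | [], _, h => h.1.mono (by simp)
  | a :: p₁, Z, h => by
    refine (Introducing.admissible h.2).mono ?_
    rintro m ((hm | hm) | ⟨y, hy, hm⟩)
    · exact .inl hm
    · exact .inr ⟨a, by simp, hm⟩
    · exact .inr ⟨y, by simp [hy], hm⟩

theorem LinStep.introducing {I J : Multiset ℤ} {st st' : List Frame} {x y : PMove}
    (h : LinStep I st x J y st') {p : List PMove}
    (hp : Introducing {m | ∃ f ∈ st', f.g = m} p) :
    Introducing {m | ∃ f ∈ st, f.g = m} (x :: y :: p) := by
  cases h with
  | count i =>
    refine ⟨⟨rfl, .inl ⟨.inl rfl, by simp⟩⟩, ⟨rfl, .inl ⟨.inl rfl, by simp⟩⟩, hp.mono ?_⟩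
    exact fun m hm => .inl (.inl hm)
  | update i g =>
    refine ⟨⟨rfl, .inl ⟨.inr rfl, by simp⟩⟩, ⟨rfl, .inr ⟨.inr ⟨rfl, rfl, .inr rfl⟩, by simp⟩⟩,
      hp.mono ?_⟩
    rintro m ⟨f, hf, rfl⟩
    obtain rfl | hf := List.mem_cons.1 hf
    · exact .inl (.inr ⟨rfl, rfl, .inr rfl⟩)
    · exact .inl (.inl ⟨f, hf, rfl⟩)
  | retry i j g I₀ _ st =>
    refine ⟨⟨rfl, .inr ⟨⟨_, List.mem_cons_self, rfl⟩, by simp⟩⟩,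
      ⟨rfl, .inr ⟨.inl ⟨_, List.mem_cons_self, rfl⟩, by simp⟩⟩, hp.mono ?_⟩
    rintro m ⟨f, hf, rfl⟩
    obtain rfl | hf := List.mem_cons.1 hf
    · exact .inl (.inl ⟨_, List.mem_cons_self, rfl⟩)
    · exact .inl (.inl ⟨f, by simp [hf], rfl⟩)
  | done i j g I₀ _ st =>
    refine ⟨⟨rfl, .inr ⟨⟨_, List.mem_cons_self, rfl⟩, by simp⟩⟩, ⟨rfl, .inl ⟨.inr rfl, by simp⟩⟩,
      hp.mono ?_⟩
    rintro m ⟨f, hf, rfl⟩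
    exact .inl (.inl ⟨f, by simp [hf], rfl⟩)

theorem AbsTrace.introducing {N : ℕ} {σ : Fin N → List Frame × Status} {I A h s}
    (H : AbsTrace σ I A h s) (l : Fin N) :
    Introducing {m | ∃ f ∈ (σ l).1, f.g = m}
      (toPMoves (s.filter fun z => z.1.tid = l + 1)) := by
  induction H with
  | nil σ I A hσ => trivial
  | opp σ I A h s k st x hk _ _ _ ih =>
    by_cases hl : l = k
    · subst hl; simpa [hk] using ih
    · simpa [Function.update_of_ne hl] using ih
  | lin σ I A h s k st st' x y J hk hL _ ih =>
    by_cases hl : l = k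
    · subst hl
      rw [filter_tid_cons_self, hk]
      exact hL.introducing (p := toPMoves _) (by simpa only [Function.update_self] using ih)
    · rw [filter_tid_cons_ne (by simpa [Fin.val_inj] using Ne.symm hl)]
      simpa [Function.update_of_ne hl] using ih
  | prop σ I A h s k st x hk _ _ ih =>
    by_cases hl : l = k
    · subst hl; simpa [hk] using ih
    · simpa [Function.update_of_ne hl] using ih

/-- The values of the two moves have no method name in common. -/
def NamesDisjoint (x y : Move) : Prop := Disjoint x.act.val.names y.act.val.names

theorem AbsTrace.pairwise {N : ℕ} {σ : Fin N → List Frame × Status} {I A h s}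
    (H : AbsTrace σ I A h s) : h.Pairwise NamesDisjoint ∧
      ∀ x ∈ h, ∀ m ∈ x.act.val.names, m ∉ A ∧ m ∉ methods := by
  induction H with
  | nil => simp
  | lin => assumption
  | opp σ I A h s k st x hk _ hx _ ih =>
    refine ⟨List.pairwise_cons.2 ⟨fun y hy => ?_, ih.1⟩, ?_⟩
    · exact Set.disjoint_left.2 fun m hm hm' => (ih.2 y hy m hm').1 (.inr hm)
    · rintro y hy m hm
      obtain rfl | hy := List.mem_cons.1 hy
      · exact hx m hm
      · exact ⟨fun h => (ih.2 y hy m hm).1 (.inl h), (ih.2 y hy m hm).2⟩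
  | prop σ I A h s k st y hk hy _ ih =>
    refine ⟨List.pairwise_cons.2 ⟨fun z _ => ?_, ih.1⟩, ?_⟩
    · simp [NamesDisjoint, hy]
    · rintro z hz m hm
      obtain rfl | hz := List.mem_cons.1 hz
      · simp [hy] at hm
      · exact ih.2 z hz m hm

theorem AbsTrace.exists_tid {N : ℕ} {σ : Fin N → List Frame × Status} {I A h s}
    (H : AbsTrace σ I A h s) : ∀ x ∈ h, ∃ k : Fin N, x.tid = k + 1 := by
  induction H with
  | nil => simp
  | lin => assumption
  | opp _ _ _ _ _ k _ _ _ _ _ _ ih => exact List.forall_mem_cons.2 ⟨⟨k, rfl⟩, ih⟩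
  | prop _ _ _ _ _ k _ _ _ _ _ ih => exact List.forall_mem_cons.2 ⟨⟨k, rfl⟩, ih⟩

/-! ### Reordering -/

/-- Swapping two adjacent moves of different threads, the first an `O`-move or the second a
`P`-move, without regard to whether the lists are histories. -/
def Exchange (h k : List Move) : Prop :=
  ∃ (s₁ s₂ : List Move) (x y : Move), x.tid ≠ y.tid ∧ (x.player = .O ∨ y.player = .P) ∧
    h = s₁ ++ x :: y :: s₂ ∧ k = s₁ ++ y :: x :: s₂

/-- Repeated exchanges. -/
def Reorders : List Move → List Move → Prop := Relation.ReflTransGen Exchange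

theorem Reorders.trans {h k l : List Move} (h₁ : Reorders h k) (h₂ : Reorders k l) :
    Reorders h l := Relation.ReflTransGen.trans h₁ h₂

theorem Reorders.append_left {h k : List Move} (H : Reorders h k) (p : List Move) :
    Reorders (p ++ h) (p ++ k) := by
  induction H with
  | refl => exact .refl
  | tail _ h ih =>
    obtain ⟨s₁, s₂, x, y, h₁, h₂, rfl, rfl⟩ := h
    exact .tail ih ⟨p ++ s₁, s₂, x, y, h₁, h₂, by simp, by simp⟩

theorem Reorders.append_right {h k : List Move} (H : Reorders h k) (p : List Move) :
    Reorders (h ++ p) (k ++ p) := by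
  induction H with
  | refl => exact .refl
  | tail _ h ih =>
    obtain ⟨s₁, s₂, x, y, h₁, h₂, rfl, rfl⟩ := h
    exact .tail ih ⟨s₁, s₂ ++ p, x, y, h₁, h₂, by simp, by simp⟩

theorem reorders_move_left {x : Move} : ∀ {B : List Move},
    (∀ b ∈ B, b.tid ≠ x.tid ∧ (b.player = .O ∨ x.player = .P)) →
      Reorders (B ++ [x]) (x :: B)
  | [], _ => .refl
  | b :: B, h =>
    have hb := h b (by simp)
    .tail ((reorders_move_left fun c hc => h c (by simp [hc])).append_left [b])
      ⟨[], B, b, x, hb.1, hb.2, rfl, rfl⟩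

theorem reorders_move_right {x : Move} : ∀ {B : List Move},
    (∀ b ∈ B, x.tid ≠ b.tid ∧ (x.player = .O ∨ b.player = .P)) →
      Reorders (x :: B) (B ++ [x])
  | [], _ => .refl
  | b :: B, h =>
    have hb := h b (by simp)
    .head ⟨[], B, x, b, hb.1, hb.2, rfl, rfl⟩
      ((reorders_move_right fun c hc => h c (by simp [hc])).append_left [b])

/-- The `O`-move of thread `k` that awaits its linearisation point. -/
def openMove {N : ℕ} (σ : Fin N → List Frame × Status) (k : Fin N) : Option Move :=
  match (σ k).2 with
  | .called x => some ⟨x, k + 1⟩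
  | _ => none

/-- The `P`-move of thread `k` that has been determined but not played. -/
def dueMove {N : ℕ} (σ : Fin N → List Frame × Status) (k : Fin N) : Option Move :=
  match (σ k).2 with
  | .lined y => some ⟨y, k + 1⟩
  | _ => none

/-- The moves that wait for a linearisation point are `O`-moves, and those determined by one are
`P`-moves. -/
def WellPolarised {N : ℕ} (σ : Fin N → List Frame × Status) : Prop :=
  ∀ k, (∀ x, (σ k).2 = .called x → x.player = .O) ∧ ∀ y, (σ k).2 = .lined y → y.player = .P

theorem openMove_spec {N : ℕ} {σ : Fin N → List Frame × Status} (hσ : WellPolarised σ)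
    {k : Fin N} {x : Move} (h : openMove σ k = some x) : x.tid = k + 1 ∧ x.player = .O := by
  unfold openMove at h
  split at h
  · cases h; exact ⟨rfl, (hσ k).1 _ ‹_›⟩
  · simp at h

theorem dueMove_spec {N : ℕ} {σ : Fin N → List Frame × Status} (hσ : WellPolarised σ)
    {k : Fin N} {x : Move} (h : dueMove σ k = some x) : x.tid = k + 1 ∧ x.player = .P := by
  unfold dueMove at h
  split at h
  · cases h; exact ⟨rfl, (hσ k).2 _ ‹_›⟩
  · simp at h

theorem openMove_update_of_ne {N : ℕ} (σ : Fin N → List Frame × Status) {k l : Fin N}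
    (h : l ≠ k) (c : List Frame × Status) :
    openMove (Function.update σ k c) l = openMove σ l := by
  simp [openMove, Function.update_of_ne h]

theorem dueMove_update_of_ne {N : ℕ} (σ : Fin N → List Frame × Status) {k l : Fin N}
    (h : l ≠ k) (c : List Frame × Status) :
    dueMove (Function.update σ k c) l = dueMove σ l := by
  simp [dueMove, Function.update_of_ne h]

/-- The moves that were played and not linearised, followed by the moves still to be played, can
be reordered to the moves that were linearised and not played, followed by the moves still to be
linearised. -/
theorem AbsTrace.reorders {N : ℕ} {σ : Fin N → List Frame × Status} {I A h s}
    (H : AbsTrace σ I A h s) (hσ : WellPolarised σ) :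
    Reorders ((List.finRange N).filterMap (openMove σ) ++ h)
      ((List.finRange N).filterMap (dueMove σ) ++ s.map Prod.fst) := by
  have split : ∀ k : Fin N, ∃ A B : List (Fin N), List.finRange N = A ++ k :: B ∧
      (∀ l ∈ A, l ≠ k) ∧ ∀ l ∈ B, l ≠ k := by
    intro k
    obtain ⟨A, B, e⟩ := List.append_of_mem (List.mem_finRange k)
    have := List.nodup_finRange N
    rw [e, List.nodup_append] at this
    refine ⟨A, B, e, fun l hl => this.2.2 l hl k (by simp), fun l hl => ?_⟩
    rintro rfl
    exact (List.nodup_cons.1 this.2.1).1 hl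
  have tid_ne : ∀ {k l : Fin N}, l ≠ k → (l : ℕ) + 1 ≠ k + 1 := by
    intro k l h; simpa [Fin.val_inj] using h
  induction H with
  | nil σ I A hσ' =>
    have h₁ : openMove σ = fun _ => none := by funext k; simp [openMove, hσ']
    have h₂ : dueMove σ = fun _ => none := by funext k; simp [dueMove, hσ']
    rw [h₁, h₂]
    exact .refl
  | opp σ I A h s k st x hk hx _ _ ih =>
    have hσ' : WellPolarised (Function.update σ k (st, .called x)) := by
      intro l
      by_cases hl : l = k
      · subst hl; simp [hx]
      · simpa [Function.update_of_ne hl] using hσ l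
    obtain ⟨A, B, e, hA, hB⟩ := split k
    have hd : dueMove (Function.update σ k (st, .called x)) = dueMove σ := by
      funext l
      by_cases hl : l = k
      · subst hl; simp [dueMove, hk]
      · exact dueMove_update_of_ne σ hl _
    have ho : openMove σ k = none := by simp [openMove, hk]
    have ho' : openMove (Function.update σ k (st, .called x)) k = some ⟨x, k + 1⟩ := by
      simp [openMove]
    have := ih hσ'
    rw [hd, e, List.filterMap_append, List.filterMap_cons_some ho',
      List.filterMap_congr fun l hl => openMove_update_of_ne σ (hA l hl) _,
      List.filterMap_congr fun l hl => openMove_update_of_ne σ (hB l hl) _] at this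
    rw [e, List.filterMap_append, List.filterMap_cons_none ho]
    refine .trans ?_ this
    have hmove := ((reorders_move_left (x := (⟨x, k + 1⟩ : Move))
      (B := B.filterMap (openMove σ)) fun b hb => ?_).append_left
        (A.filterMap (openMove σ))).append_right h
    · simpa using hmove
    · obtain ⟨l, hl, hb⟩ := List.mem_filterMap.1 hb
      have := openMove_spec hσ hb
      exact ⟨by rw [this.1]; exact tid_ne (hB l hl), .inl this.2⟩
  | lin σ I A h s k st st' x y J hk hL _ ih =>
    have hσ' : WellPolarised (Function.update σ k (st', .lined y)) := by
      intro l
      by_cases hl : l = k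
      · subst hl; simp [hL.players]
      · simpa [Function.update_of_ne hl] using hσ l
    obtain ⟨A, B, e, hA, hB⟩ := split k
    have ho : openMove σ k = some ⟨x, k + 1⟩ := by simp [openMove, hk]
    have ho' : openMove (Function.update σ k (st', .lined y)) k = none := by simp [openMove]
    have hd : dueMove σ k = none := by simp [dueMove, hk]
    have hd' : dueMove (Function.update σ k (st', .lined y)) k = some ⟨y, k + 1⟩ := by
      simp [dueMove]
    have := ih hσ'
    rw [e, List.filterMap_append, List.filterMap_append, List.filterMap_cons_none ho',
      List.filterMap_cons_some hd',
      List.filterMap_congr fun l hl => openMove_update_of_ne σ (hA l hl) _,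
      List.filterMap_congr fun l hl => openMove_update_of_ne σ (hB l hl) _,
      List.filterMap_congr fun l hl => dueMove_update_of_ne σ (hA l hl) _,
      List.filterMap_congr fun l hl => dueMove_update_of_ne σ (hB l hl) _] at this
    rw [e, List.filterMap_append, List.filterMap_append, List.filterMap_cons_some ho,
      List.filterMap_cons_none hd]
    have hP : ∀ C : List (Fin N), (∀ l ∈ C, l ≠ k) → ∀ b ∈ C.filterMap (dueMove σ),
        (k : ℕ) + 1 ≠ b.tid ∧ b.player = .P := by
      intro C hC b hb
      obtain ⟨l, hl, hb⟩ := List.mem_filterMap.1 hb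
      have := dueMove_spec hσ hb
      exact ⟨by rw [this.1]; exact (tid_ne (hC l hl)).symm, this.2⟩
    -- `x` moves to the front of the list on the left ...
    have h₁ := (reorders_move_left (x := (⟨x, k + 1⟩ : Move))
      (B := A.filterMap (openMove σ)) fun b hb => by
        obtain ⟨l, hl, hb⟩ := List.mem_filterMap.1 hb
        have := openMove_spec hσ hb
        exact ⟨by rw [this.1]; exact tid_ne (hA l hl), .inl this.2⟩).append_right
          (B.filterMap (openMove σ) ++ h)
    -- ... and, in the list on the right, `x` and `y` move to their place in the linearisation.
    have h₂ := ((reorders_move_right (x := (⟨y, k + 1⟩ : Move))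
      (B := B.filterMap (dueMove σ)) fun b hb => by
        exact ⟨(hP B hB b hb).1, .inr (hP B hB b hb).2⟩).append_left
          ((⟨x, k + 1⟩ : Move) :: A.filterMap (dueMove σ))).append_right (s.map Prod.fst)
    have h₃ := (reorders_move_right (x := (⟨x, k + 1⟩ : Move))
      (B := A.filterMap (dueMove σ) ++ B.filterMap (dueMove σ)) fun b hb => by
        refine ⟨?_, .inl hL.players.1⟩
        obtain hb | hb := List.mem_append.1 hb
        · exact (hP A hA b hb).1
        · exact (hP B hB b hb).1).append_right ((⟨y, k + 1⟩ : Move) :: s.map Prod.fst)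
    have h₄ := this.append_left [(⟨x, k + 1⟩ : Move)]
    simp only [List.append_assoc, List.cons_append, List.nil_append, List.map_cons] at h₁ h₂ h₃ h₄ ⊢
    exact h₁.trans (h₄.trans (h₂.trans h₃))
  | prop σ I A h s k st y hk hy _ ih =>
    have hσ' : WellPolarised (Function.update σ k (st, .idle)) := by
      intro l
      by_cases hl : l = k
      · subst hl; simp
      · simpa [Function.update_of_ne hl] using hσ l
    have hyP : y.player = .P := (hσ k).2 y (by rw [hk])
    obtain ⟨A, B, e, hA, hB⟩ := split k
    have ho : openMove (Function.update σ k (st, .idle)) = openMove σ := by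
      funext l
      by_cases hl : l = k
      · subst hl; simp [openMove, hk]
      · exact openMove_update_of_ne σ hl _
    have hd : dueMove σ k = some ⟨y, k + 1⟩ := by simp [dueMove, hk]
    have hd' : dueMove (Function.update σ k (st, .idle)) k = none := by simp [dueMove]
    have := ih hσ'
    rw [ho] at this
    have h₁ := (reorders_move_left (x := (⟨y, k + 1⟩ : Move))
      (B := (List.finRange N).filterMap (openMove σ)) fun b hb => by
        obtain ⟨l, hl, hb⟩ := List.mem_filterMap.1 hb
        have hs := openMove_spec hσ hb
        refine ⟨?_, .inr hyP⟩
        rw [hs.1]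
        refine tid_ne ?_
        rintro rfl
        simp [openMove, hk] at hb).append_right h
    have h₂ := (reorders_move_right (x := (⟨y, k + 1⟩ : Move))
      (B := A.filterMap (dueMove σ)) fun b hb => by
        obtain ⟨l, hl, hb⟩ := List.mem_filterMap.1 hb
        have hs := dueMove_spec hσ hb
        exact ⟨by rw [hs.1]; exact (tid_ne (hA l hl)).symm, .inr hs.2⟩).append_right
          (B.filterMap (dueMove σ) ++ s.map Prod.fst)
    have h₃ := this.append_left [(⟨y, k + 1⟩ : Move)]
    have e₁ : (List.finRange N).filterMap (dueMove (Function.update σ k (st, .idle))) =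
        A.filterMap (dueMove σ) ++ B.filterMap (dueMove σ) := by
      rw [e, List.filterMap_append, List.filterMap_cons_none hd',
        List.filterMap_congr fun l hl => dueMove_update_of_ne σ (hA l hl) _,
        List.filterMap_congr fun l hl => dueMove_update_of_ne σ (hB l hl) _]
    have e₂ : (List.finRange N).filterMap (dueMove σ) =
        A.filterMap (dueMove σ) ++ ⟨y, k + 1⟩ :: B.filterMap (dueMove σ) := by
      rw [e, List.filterMap_append, List.filterMap_cons_some hd]
    rw [e₁] at h₃
    rw [e₂]
    simp only [List.append_assoc, List.cons_append, List.nil_append] at h₁ h₂ h₃ ⊢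
    exact h₁.trans (h₃.trans h₂)

/-! ### Histories -/

/-- A sufficient condition for being a history that mentions the order of the moves of each thread
only, so that it is not affected by exchanging moves of different threads. -/
structure Good (N : ℕ) (h : List Move) : Prop where
  exists_tid : ∀ x ∈ h, ∃ k : Fin N, x.tid = k + 1
  preHist : ∀ k : Fin N, PreHist .O (threadProj (k + 1) h)
  introducing : ∀ k : Fin N, Introducing ∅ (threadProj (k + 1) h)
  pairwise : h.Pairwise NamesDisjoint
  notMem : ∀ x ∈ h, ∀ m ∈ x.act.val.names, m ∉ methods

theorem threadProj_append (t : ℕ) (h k : List Move) :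
    threadProj t (h ++ k) = threadProj t h ++ threadProj t k := by
  simp [threadProj]

theorem Exchange.threadProj_eq {h k : List Move} (H : Exchange h k) (t : ℕ) :
    threadProj t h = threadProj t k := by
  obtain ⟨s₁, s₂, x, y, h₁, -, rfl, rfl⟩ := H
  rw [threadProj_append, threadProj_append]
  congr 1
  by_cases hx : x.tid = t <;> by_cases hy : y.tid = t <;> simp_all [threadProj]

theorem Exchange.perm {h k : List Move} (H : Exchange h k) : h.Perm k := by
  obtain ⟨s₁, s₂, x, y, -, -, rfl, rfl⟩ := H
  exact (List.Perm.swap y x s₂).append_left s₁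

theorem Good.exchange {N : ℕ} {h k : List Move} (hg : Good N h) (H : Exchange h k) :
    Good N k where
  exists_tid x hx := hg.exists_tid x (H.perm.mem_iff.2 hx)
  preHist l := H.threadProj_eq _ ▸ hg.preHist l
  introducing l := H.threadProj_eq _ ▸ hg.introducing l
  pairwise := (H.perm.pairwise_iff fun h => Disjoint.symm h).1 hg.pairwise
  notMem x hx := hg.notMem x (H.perm.mem_iff.2 hx)

theorem Good.admissible {N : ℕ} {h s₁ s₂ : List Move} {x : Move} (hg : Good N h)
    (e : h = s₁ ++ x :: s₂) :
    Admissible {m | ∃ y ∈ s₁, m ∈ introduced y.toPMove} x.toPMove := by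
  obtain ⟨k, hk⟩ := hg.exists_tid x (by simp [e])
  have := hg.introducing k
  have hx : threadProj (k + 1) (x :: s₂) = x.toPMove :: threadProj (k + 1) s₂ := by
    simp [threadProj, hk]
  rw [e, threadProj_append, hx] at this
  refine this.admissible.mono ?_
  rintro m (hm | ⟨y, hy, hm⟩)
  · simp at hm
  · simp only [threadProj, List.mem_map, List.mem_filter] at hy
    obtain ⟨z, hz, rfl⟩ := hy
    exact ⟨z, hz.1, hm⟩

theorem Good.mem_hist {N : ℕ} (hN : 0 < N) {h : List Move} (hg : Good N h) :
    h ∈ Hist ∅ methods := by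
  refine ⟨⟨N, hN, fun x hx => ?_, fun t h₁ h₂ => ?_⟩, ?_, ?_⟩
  · obtain ⟨k, hk⟩ := hg.exists_tid x hx
    omega
  · have := hg.preHist ⟨t - 1, by omega⟩
    rwa [show t - 1 + 1 = t by omega] at this
  · intro s₁ s₂ x m v e hx
    obtain ⟨hK, ⟨hm, hO⟩ | ⟨⟨y, hy, hm⟩, hP⟩⟩ := hg.admissible e
    · rw [hx] at hm
      exact .inl ⟨hm, hO _ _ hx, hK⟩
    · rw [hx] at hm
      refine .inr (.inr ⟨y, hy, ?_, hm.2.1.trans hK.symm, hm.2.2⟩)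
      rw [hm.1, hP _ _ hx]
      decide
  · intro s₁ s₂ x e m hm y hy
    have hd : ∀ z ∈ s₁, m ∉ z.act.val.names := by
      intro z hz hm'
      have := hg.pairwise
      rw [e, List.pairwise_append] at this
      exact Set.disjoint_left.1 (this.2.2 z hz x (by simp)) hm' hm
    refine ⟨?_, hd y hy⟩
    rintro rfl
    obtain ⟨a, b, rfl⟩ := List.append_of_mem hy
    obtain ⟨-, ⟨hm', -⟩ | ⟨⟨z, hz, hm'⟩, -⟩⟩ :=
      hg.admissible (s₁ := a) (x := y) (s₂ := b ++ x :: s₂) (by simp [e])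
    · exact hg.notMem x (by simp [e]) _ hm hm'
    · exact hd z (by simp [hz]) hm'.2.2

theorem Good.linearisedBy {N : ℕ} (hN : 0 < N) {h k : List Move} (hg : Good N h)
    (H : Reorders h k) : Good N k ∧ LinearisedBy ∅ methods h k := by
  induction H with
  | refl => exact ⟨hg, hg.mem_hist hN, hg.mem_hist hN, .refl⟩
  | tail _ hx ih =>
    have hk := ih.1.exchange hx
    exact ⟨hk, ih.2.1, hk.mem_hist hN, .tail ih.2.2.2 ⟨ih.2.2.1, hk.mem_hist hN, hx⟩⟩

theorem Reorders.threadProj_eq {h k : List Move} (H : Reorders h k) (t : ℕ) :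
    threadProj t h = threadProj t k := by
  induction H with
  | refl => rfl
  | tail _ hx ih => exact ih.trans (hx.threadProj_eq t)

theorem Reorders.perm {h k : List Move} (H : Reorders h k) : h.Perm k := by
  induction H with
  | refl => rfl
  | tail _ hx ih => exact ih.trans hx.perm

theorem threadProj_map_fst (t : ℕ) (s : List ExtMove) :
    threadProj t (s.map Prod.fst) = toPMoves (s.filter fun z => z.1.tid = t) := by
  simp [threadProj, toPMoves, List.filter_map, Function.comp_def]

/-- The linearisation points of a complete abstract run yield a linearisation in the
specification. -/
theorem AbsTrace.exists_spec {N : ℕ} (hN : 0 < N) {A : Set Meth} {h : List Move}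
    {s : List ExtMove} (H : AbsTrace (fun _ : Fin N => ([], .idle)) 0 A h s) :
    ∃ h' ∈ spec, LinearisedBy ∅ methods h h' := by
  have hr : Reorders h (s.map Prod.fst) := by
    have := H.reorders (by intro k; simp)
    have h₁ : openMove (fun _ : Fin N => (([] : List Frame), Status.idle)) = fun _ => none := by
      funext k; simp [openMove]
    have h₂ : dueMove (fun _ : Fin N => (([] : List Frame), Status.idle)) = fun _ => none := by
      funext k; simp [dueMove]
    have h₃ : (List.finRange N).filterMap (fun _ => (none : Option Move)) = [] := by simp
    rw [h₁, h₂, h₃] at this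
    exact this
  have hg : Good N h :=
    { exists_tid := H.exists_tid
      preHist := fun k => by
        rw [hr.threadProj_eq, threadProj_map_fst]
        exact (H.remaining k).2
      introducing := fun k => by
        rw [hr.threadProj_eq, threadProj_map_fst]
        exact (H.introducing k).mono (by simp)
      pairwise := H.pairwise.1
      notMem := fun x hx m hm => (H.pairwise.2 x hx m hm).2 }
  obtain ⟨hg', hl⟩ := hg.linearisedBy hN hr
  refine ⟨s.map Prod.fst, ⟨s, ⟨⟨hl.2.1, H.chained.sequential⟩, H.chained.head,
    H.chained.adjacent, fun t => ?_⟩, rfl⟩, hl⟩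
  by_cases ht : ∃ k : Fin N, t = k + 1
  · obtain ⟨k, rfl⟩ := ht
    exact (H.remaining k).1
  · have : s.filter (fun x => x.1.tid = t) = [] := by
      rw [List.filter_eq_nil_iff]
      intro x hx
      obtain ⟨k, hk⟩ := hg'.exists_tid x.1 (List.mem_map_of_mem hx)
      simp only [decide_eq_true_eq]
      exact fun e => ht ⟨k, e ▸ hk⟩
    rw [this]
    exact .nil

/-! ### The states of a thread at its non-local steps -/

/-- The body of `count` applied to `i`. -/
def readTerm (i : ℤ) : Term := callRef fRef (.int i)

/-- The body of `update` applied to `(i, g)`, where `!upd_r` has been evaluated to `m₀`. -/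
def startTerm (m₀ : Meth) (i : ℤ) (g : Meth) : Term :=
  .app (.meth m₀) (.pair (.int i) (.pair (.meth g) (readTerm i)))

/-- The success branch of `upd_r`, with `Y` for the new value and `f` for the content of `F`. -/
def succTerm (i : ℤ) (Y f : Term) : Term :=
  seq (.assign fRef (.lam vx .int (.ite (.op .eq (.var vx) (.int i)) Y (.app f (.var vx)))))
    (seq (.release lockRef) Y)

/-- The failure branch of `upd_r`. -/
def failTerm (i : ℤ) (g : Meth) (f : Term) : Term :=
  seq (.release lockRef)
    (callRef updRRef (.pair (.int i) (.pair (.meth g) (.app f (.int i)))))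

/-- The conditional of `upd_r`. -/
def branchTerm (i : ℤ) (g : Meth) (n : ℤ) (Y f : Term) : Term :=
  .ite (.op .eq (.int n) (.app f (.int i))) (succTerm i Y f) (failTerm i g f)

/-- The part of `upd_r` after the acquisition of the lock. -/
def lockedTerm (i : ℤ) (g : Meth) (n : ℤ) (Y : Term) : Term :=
  .letIn vf (.deref fRef) (branchTerm i g n Y (.var vf))

/-- The part of `upd_r` after the evaluation of `|g j|`. -/
def tailTerm (i : ℤ) (g : Meth) (n : ℤ) (Y : Term) : Term :=
  seq (.acquire lockRef) (lockedTerm i g n Y)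

/-- The context in which `upd_r` calls `g` with argument `n`. -/
def callCtx (i : ℤ) (g : Meth) (n : ℤ) : ECtx :=
  .letIn vy (.letIn 102 .hole
    (.ite (.op .lt (.var 102) (.int 0)) (.op .sub (.int 0) (.var 102)) (.var 102)))
    (tailTerm i g n (.var vy))

/-- The call of `g` in `upd_r`. -/
def callTerm (i : ℤ) (g : Meth) (n : ℤ) : Term :=
  (callCtx i g n).fill (.app (.meth g) (.int n))

/-- The method `m` represents the function `φ`: it is `λx. 0`, or it was created by a successful
update and overrides the function represented by another method in one point. -/
inductive Represents (R : Repo) : Meth → (ℤ → ℤ) → Prop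
  | zero (m : Meth) : R m = some ⟨vx, .int 0⟩ → Represents R m fun _ => 0
  | override (m m' : Meth) (i y : ℤ) (φ : ℤ → ℤ) :
      R m = some ⟨vx, .ite (.op .eq (.var vx) (.int i)) (.int y) (.app (.meth m') (.var vx))⟩ →
      Represents R m' φ → Represents R m (Function.update φ i y)

/-- Local steps in which the reference to `upd_r` has the constant content `m₀`. -/
abbrev Local (R : Repo) (m₀ : Meth) : Term → Term → Prop := LSteps R updRRef m₀

theorem Represents.mono {R R' : Repo} (hR : ∀ m a, R m = some a → R' m = some a) {m : Meth}
    {φ : ℤ → ℤ} (h : Represents R m φ) : Represents R' m φ := by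
  induction h with
  | zero m h => exact .zero m (hR _ _ h)
  | override m m' i y φ h _ ih => exact .override m m' i y φ (hR _ _ h) ih

theorem lstep_app {R : Repo} {ref : Ref} {m₀ m : Meth} {M : Term} {v : Val} {a : Abs}
    (hm : R m = some a) (hM : M.toVal? = some v) :
    lstep R ref m₀ (.app (.meth m) M) = some (a.body.subst a.x v) := by
  simp [lstep, decomp, hM, contract, hm, ECtx.fill]

theorem Represents.local {R : Repo} {m : Meth} {φ : ℤ → ℤ} (h : Represents R m φ) (m₀ : Meth)
    (k : ℤ) : Local R m₀ (.app (.meth m) (.int k)) (.int (φ k)) := by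
  induction h with
  | zero m h => exact .head (lstep_app h rfl) .refl
  | override m m' i y φ h _ ih =>
    refine .head (lstep_app h rfl) (.head rfl (.head rfl ?_))
    by_cases hk : k = i
    · subst hk
      simp only [BinOp.eval, ECtx.fill, if_true, one_ne_zero, if_false, Function.update_self]
      exact .refl
    · simpa [BinOp.eval, ECtx.fill, Term.subst, hk, Val.toTerm] using ih

theorem local_count {R : Repo} {m₀ : Meth} (i : ℤ) :
    Local R m₀ (countBody.subst vi (.int i)) (readTerm i) := .refl

theorem local_read {R : Repo} {m₀ m : Meth} {φ : ℤ → ℤ} (h : Represents R m φ) (i : ℤ) :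
    Local R m₀ (.letIn 101 (.meth m) (.app (.var 101) (.int i))) (.int (φ i)) :=
  .head rfl (h.local m₀ i)

theorem local_update {R : Repo} {m₀ : Meth} (i : ℤ) (g : Meth) :
    Local R m₀ (updateBody.subst vp (.pair (.int i) (.meth g))) (startTerm m₀ i g) :=
  .head rfl (.head rfl (.head rfl (.head rfl (.head rfl (.head rfl .refl)))))

theorem local_updR {R : Repo} {m₀ : Meth} (h : R m₀ = some ⟨vp, updRBody⟩) (i n : ℤ)
    (g : Meth) :
    Local R m₀ (.app (.meth m₀) (.pair (.int i) (.pair (.meth g) (.int n)))) (callTerm i g n) :=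
  .head (lstep_app h rfl) (.head rfl (.head rfl (.head rfl (.head rfl (.head rfl
    (.head rfl (.head rfl (.head rfl .refl))))))))

theorem local_abs {R : Repo} {m₀ : Meth} (i n j : ℤ) (g : Meth) :
    Local R m₀ ((callCtx i g n).fill (.int j)) (tailTerm i g n (.int |j|)) := by
  refine .head rfl (.head rfl (.head rfl ?_))
  by_cases hj : j < 0
  · simp only [BinOp.eval, hj, if_true, one_ne_zero, if_false]
    refine .head rfl (.head rfl ?_)
    simp only [BinOp.eval, zero_sub, abs_of_neg hj]
    exact .refl
  · simp only [BinOp.eval, hj, if_true, if_false]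
    refine .head rfl ?_
    rw [abs_of_nonneg (not_lt.1 hj)]
    exact .refl

theorem local_branch {R : Repo} {m₀ m : Meth} {φ : ℤ → ℤ} (h : Represents R m φ) (i n y : ℤ)
    (g : Meth) :
    Local R m₀ (.letIn vf (.meth m) (branchTerm i g n (.int y) (.var vf)))
      (if n = φ i then succTerm i (.int y) (.meth m) else failTerm i g (.meth m)) := by
  refine .head rfl (.trans ((h.local m₀ i).fill
    (.ite (.opR .eq n .hole) (succTerm i (.int y) (.meth m)) (failTerm i g (.meth m)))) ?_)
  refine .head rfl (.head rfl ?_)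
  by_cases hn : n = φ i
  · simpa [BinOp.eval, hn, ECtx.fill] using Relation.ReflTransGen.refl
  · simpa [BinOp.eval, hn, ECtx.fill] using Relation.ReflTransGen.refl

theorem local_retry {R : Repo} {m₀ m : Meth} {φ : ℤ → ℤ} (h : Represents R m φ)
    (h₀ : R m₀ = some ⟨vp, updRBody⟩) (i : ℤ) (g : Meth) :
    Local R m₀
      (.letIn 100 .unit (callRef updRRef (.pair (.int i) (.pair (.meth g)
        (.app (.meth m) (.int i)))))) (callTerm i g (φ i)) :=
  .head rfl (.head rfl (.head rfl (.trans ((h.local m₀ i).fill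
    (.app m₀ (.pairR (.int i) (.pairR (.meth g) .hole)))) (local_updR h₀ i _ g))))

/-! ### The simulation relation -/

/-- The evaluation stack of an idle thread with the given pending calls. -/
def stackOf : List Frame → List StackItem
  | [] => []
  | f :: st => .meth f.g :: .ctx (callCtx f.i f.g (f.I.count f.i)) :: .meth update :: stackOf st

/-- `AtPoint e m₀ I held st c m M`: a thread whose term is `M`, just before a step that is not
local, is executing the public method `m` above the pending calls `st` and is in the abstract
state `c`.  The current multiset is `I`, and `held` says that the thread holds the lock. -/
inductive AtPoint (e : Env) (m₀ : Meth) (I : Multiset ℤ) (held : Prop) (st : List Frame) :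
    List Frame × Status → Meth → Term → Prop
  | count (i : ℤ) : ¬ held →
      AtPoint e m₀ I held st (st, .called ⟨.call count (.int i), .O, .K⟩) count (readTerm i)
  | countRet (n : ℤ) : ¬ held →
      AtPoint e m₀ I held st (st, .lined ⟨.ret count (.int n), .P, .K⟩) count (.int n)
  | update (i : ℤ) (g : Meth) : ¬ held → g ∈ e.abs .K →
      AtPoint e m₀ I held st
        (st, .called ⟨.call update (.pair (.int i) (.meth g)), .O, .K⟩) update
        (startTerm m₀ i g)
  | call (i : ℤ) (g : Meth) (I₀ : Multiset ℤ) : ¬ held → g ∈ e.abs .K →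
      AtPoint e m₀ I held st
        (⟨g, i, I₀⟩ :: st, .lined ⟨.call g (.int (I₀.count i)), .P, .K⟩) update
        (callTerm i g (I₀.count i))
  | acquire (i j : ℤ) (g : Meth) (I₀ : Multiset ℤ) : ¬ held → g ∈ e.abs .K →
      AtPoint e m₀ I held st
        (⟨g, i, I₀⟩ :: st, .called ⟨.ret g (.int j), .O, .K⟩) update
        (tailTerm i g (I₀.count i) (.int |j|))
  | locked (i j : ℤ) (g : Meth) (I₀ : Multiset ℤ) : held → g ∈ e.abs .K →
      AtPoint e m₀ I held st
        (⟨g, i, I₀⟩ :: st, .called ⟨.ret g (.int j), .O, .K⟩) update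
        (lockedTerm i g (I₀.count i) (.int |j|))
  | closure (i j : ℤ) (g m : Meth) (I₀ : Multiset ℤ) : held → g ∈ e.abs .K →
      I₀.count i = I.count i → e.store fRef = some (.meth m) →
      AtPoint e m₀ I held st
        (⟨g, i, I₀⟩ :: st, .called ⟨.ret g (.int j), .O, .K⟩) update
        (succTerm i (.int |j|) (.meth m))
  | assign (i j : ℤ) (g m : Meth) (I₀ : Multiset ℤ) : held → g ∈ e.abs .K →
      I₀.count i = I.count i →
      Represents e.repo m (Function.update (fun k => (I.count k : ℤ)) i |j|) →
      AtPoint e m₀ I held st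
        (⟨g, i, I₀⟩ :: st, .called ⟨.ret g (.int j), .O, .K⟩) update
        (seq (.assign fRef (.meth m)) (seq (.release lockRef) (.int |j|)))
  | release (y : ℤ) : held →
      AtPoint e m₀ I held st (st, .lined ⟨.ret update (.int y), .P, .K⟩) update
        (seq (.release lockRef) (.int y))
  | updateRet (y : ℤ) : ¬ held →
      AtPoint e m₀ I held st (st, .lined ⟨.ret update (.int y), .P, .K⟩) update (.int y)
  | releaseFail (i : ℤ) (g m : Meth) (I₀ : Multiset ℤ) : held → g ∈ e.abs .K →
      Represents e.repo m (fun k => I₀.count k) →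
      AtPoint e m₀ I held st
        (⟨g, i, I₀⟩ :: st, .lined ⟨.call g (.int (I₀.count i)), .P, .K⟩) update
        (failTerm i g (.meth m))

/-- The thread `C` is in the abstract state `c`; its term, if any, reaches one of the points of
`AtPoint` by local steps. -/
inductive ThreadInv (e : Env) (m₀ : Meth) (I : Multiset ℤ) (held : Prop) :
    List Frame × Status → Thread → Prop
  | idle (st : List Frame) : ¬ held → ThreadInv e m₀ I held (st, .idle) ⟨stackOf st, none⟩
  | active (st : List Frame) (c : List Frame × Status) (m : Meth) (M M₀ : Term) :
      Local e.repo m₀ M M₀ → AtPoint e m₀ I held st c m M₀ →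
      ThreadInv e m₀ I held c ⟨.meth m :: stackOf st, some M⟩

/-- The shared components represent the multiset `I`; the lock is taken if and only if `locked`;
`m₀` is the method `upd_r`. -/
structure EnvInv (e : Env) (m₀ : Meth) (I : Multiset ℤ) (locked : Bool) : Prop where
  pubK : e.pub .K = methods
  pubL : e.pub .L = ∅
  absL : e.abs .L = ∅
  absK : ∀ m ∈ e.abs .K, (m.dom = .int ∧ m.cod = .int) ∧ e.repo m = none
  repo_count : e.repo count = some ⟨vi, countBody⟩
  repo_update : e.repo update = some ⟨vp, updateBody⟩
  repo_updR : e.repo m₀ = some ⟨vp, updRBody⟩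
  store_updR : e.store updRRef = some (.meth m₀)
  store_f : ∃ m, e.store fRef = some (.meth m) ∧ Represents e.repo m fun k => I.count k
  store_lock : e.store lockRef = some (.int (if locked then 1 else 0))

/-- The simulation relation between configurations and abstract states; `holder` is the thread
that holds the lock. -/
def Simulates {N : ℕ} (ρ : NConf N) (m₀ : Meth) (σ : Fin N → List Frame × Status)
    (I : Multiset ℤ) (holder : Option (Fin N)) : Prop :=
  EnvInv ρ.env m₀ I holder.isSome ∧
    ∀ k, ThreadInv ρ.env m₀ I (holder = some k) (σ k) (ρ.threads k)

/-- The repository and the set of abstract names of `e'` extend those of `e`. -/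
def Env.Extends (e e' : Env) : Prop :=
  (∀ m a, e.repo m = some a → e'.repo m = some a) ∧ e.abs .K ⊆ e'.abs .K

theorem Env.Extends.refl (e : Env) : Env.Extends e e := ⟨fun _ _ h => h, subset_rfl⟩

theorem AtPoint.mono {e e' : Env} {m₀ : Meth} {I I' : Multiset ℤ} {held : Prop}
    {st : List Frame} {c : List Frame × Status} {m : Meth} {M : Term}
    (h : AtPoint e m₀ I held st c m M) (he : Env.Extends e e')
    (hI : held → I' = I ∧ e'.store fRef = e.store fRef) : AtPoint e' m₀ I' held st c m M := by
  cases h with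
  | count i h => exact .count i h
  | countRet n h => exact .countRet n h
  | update i g h hg => exact .update i g h (he.2 hg)
  | call i g I₀ h hg => exact .call i g I₀ h (he.2 hg)
  | acquire i j g I₀ h hg => exact .acquire i j g I₀ h (he.2 hg)
  | locked i j g I₀ h hg => exact .locked i j g I₀ h (he.2 hg)
  | closure i j g m I₀ h hg hc hs =>
    exact .closure i j g m I₀ h (he.2 hg) ((hI h).1 ▸ hc) ((hI h).2 ▸ hs)
  | assign i j g m I₀ h hg hc hr =>
    obtain ⟨rfl, -⟩ := hI h
    exact .assign i j g m I₀ h (he.2 hg) hc (hr.mono he.1)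
  | release y h => exact .release y h
  | updateRet y h => exact .updateRet y h
  | releaseFail i g m I₀ h hg hr => exact .releaseFail i g m I₀ h (he.2 hg) (hr.mono he.1)

theorem ThreadInv.mono {e e' : Env} {m₀ : Meth} {I I' : Multiset ℤ} {held : Prop}
    {c : List Frame × Status} {C : Thread}
    (h : ThreadInv e m₀ I held c C) (he : Env.Extends e e')
    (hI : held → I' = I ∧ e'.store fRef = e.store fRef) : ThreadInv e' m₀ I' held c C := by
  cases h with
  | idle st h => exact .idle st h
  | active st c m M M₀ hM h => exact .active st c m M M₀ (hM.mono he.1) (h.mono he hI)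

/-- A step of thread `k` keeps the simulation relation if the other threads neither gain nor lose
the lock and the multiset and the content of `F` change only while `k` holds the lock. -/
theorem Simulates.update {N : ℕ} {ρ : NConf N} {m₀ : Meth} {σ : Fin N → List Frame × Status}
    {I I' : Multiset ℤ} {holder holder' : Option (Fin N)} (H : Simulates ρ m₀ σ I holder)
    {k : Fin N} {C : Thread} {e' : Env} {c : List Frame × Status}
    (hE : EnvInv e' m₀ I' holder'.isSome) (hC : ThreadInv e' m₀ I' (holder' = some k) c C)
    (he : Env.Extends ρ.env e') (hh : ∀ l ≠ k, holder' = some l ↔ holder = some l)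
    (hI : holder = some k ∨ I' = I ∧ e'.store fRef = ρ.env.store fRef) :
    Simulates ⟨Function.update ρ.threads k C, e'⟩ m₀ (Function.update σ k c) I' holder' := by
  refine ⟨hE, fun l => ?_⟩
  by_cases hl : l = k
  · subst hl; simpa using hC
  · simp only [Function.update_of_ne hl, hh l hl]
    refine (H.2 l).mono he fun h => hI.resolve_left ?_
    rw [h]
    simpa using hl

theorem EnvInv.store_update_lock {e : Env} {m₀ : Meth} {I : Multiset ℤ} {b : Bool}
    (h : EnvInv e m₀ I b) (b' : Bool) :
    EnvInv { e with
      store := Function.update e.store lockRef (some (.int (if b' then 1 else 0))) } m₀ I b' :=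
  { h with
    store_updR := by simpa [updRRef, lockRef] using h.store_updR
    store_f := by simpa [fRef, lockRef] using h.store_f
    store_lock := by simp }

theorem EnvInv.store_update_f {e : Env} {m₀ m : Meth} {I I' : Multiset ℤ} {b : Bool}
    (h : EnvInv e m₀ I b) (hm : Represents e.repo m fun k => I'.count k) :
    EnvInv { e with store := Function.update e.store fRef (some (.meth m)) } m₀ I' b :=
  { h with
    store_updR := by simpa [updRRef, fRef, updRDom] using h.store_updR
    store_f := ⟨m, by simp, hm⟩
    store_lock := by simpa [fRef, lockRef] using h.store_lock }

theorem extends_update {e : Env} {m : Meth} (a : Abs) (hm : e.repo m = none) :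
    Env.Extends e { e with repo := Function.update e.repo m (some a) } := by
  refine ⟨fun n b hn => ?_, subset_rfl⟩
  have : n ≠ m := by rintro rfl; simp [hm] at hn
  simpa [Function.update_of_ne this] using hn

theorem EnvInv.repo_insert {e : Env} {m₀ m : Meth} {I : Multiset ℤ} {b : Bool}
    (h : EnvInv e m₀ I b) (a : Abs) (hm : e.repo m = none) (hm' : m ∉ e.abs .K) :
    EnvInv { e with repo := Function.update e.repo m (some a) } m₀ I b := by
  have he := (extends_update a hm).1
  obtain ⟨f, hf, hr⟩ := h.store_f
  refine { h with
    absK := fun n hn => ⟨(h.absK n hn).1, ?_⟩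
    repo_count := he _ _ h.repo_count
    repo_update := he _ _ h.repo_update
    repo_updR := he _ _ h.repo_updR
    store_f := ⟨f, hf, hr.mono he⟩ }
  have : n ≠ m := by rintro rfl; exact hm' hn
  simpa [Function.update_of_ne this] using (h.absK n hn).2

theorem count_setMult (I : Multiset ℤ) (i : ℤ) (n : ℕ) (k : ℤ) :
    (setMult I i n).count k = Function.update (fun k => I.count k) i n k := by
  by_cases hk : k = i
  · subst hk
    simp [setMult]
  · simp [setMult, hk, Multiset.count_replicate, Ne.symm hk]

theorem represents_setMult {R : Repo} {m : Meth} {I : Multiset ℤ} {i j : ℤ}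
    (h : Represents R m (Function.update (fun k => (I.count k : ℤ)) i |j|)) :
    Represents R m fun k => (setMult I i j.natAbs).count k := by
  convert h using 2 with k
  by_cases hk : k = i
  · subst hk; simp [count_setMult]
  · simp [count_setMult, hk]

theorem ThreadInv.of_local {e : Env} {m₀ : Meth} {I : Multiset ℤ} {held : Prop}
    {st : List Frame} {c : List Frame × Status} {m : Meth} {M M₀ : Term}
    (h : AtPoint e m₀ I held st c m M₀) (hM : Local e.repo m₀ M M₀) :
    ThreadInv e m₀ I held c ⟨.meth m :: stackOf st, some M⟩ :=
  .active st c m M M₀ hM h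

/-- An internal step is matched by the abstract system, in zero steps or by passing a
linearisation point. -/
theorem Simulates.int {N : ℕ} {ρ : NConf N} {m₀ : Meth} {σ : Fin N → List Frame × Status}
    {I : Multiset ℤ} {holder : Option (Fin N)} (H : Simulates ρ m₀ σ I holder) {k : Fin N}
    {t : ℕ} {C : Thread} {e : Env} (hstep : IntStep t (ρ.threads k) ρ.env C e) :
    e.abs = ρ.env.abs ∧ ∃ σ' I' holder',
      Simulates ⟨Function.update ρ.threads k C, e⟩ m₀ σ' I' holder' ∧
      ∀ A h s, AbsTrace σ' I' A h s → ∃ s', AbsTrace σ I A h s' := by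
  obtain ⟨hE, hT⟩ := H
  have hk := hT k
  generalize hc : σ k = c at hk
  generalize hCk : ρ.threads k = Ck at hk hstep
  cases hstep with
  | mk St M M' _ R' S' hM hnew =>
    refine ⟨rfl, ?_⟩
    -- Steps that keep the abstract state
    have stay : ∀ {holder' : Option (Fin N)} {C : Thread} {e' : Env},
        EnvInv e' m₀ I holder'.isSome → ThreadInv e' m₀ I (holder' = some k) c C →
        Env.Extends ρ.env e' → (∀ l ≠ k, holder' = some l ↔ holder = some l) →
        e'.store fRef = ρ.env.store fRef →
        ∃ σ' I' holder', Simulates ⟨Function.update ρ.threads k C, e'⟩ m₀ σ' I' holder' ∧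
          ∀ A h s, AbsTrace σ' I' A h s → ∃ s', AbsTrace σ I A h s' := by
      intro holder' C e' h₁ h₂ h₃ h₄ h₅
      refine ⟨σ, I, holder', ?_, fun A h s H => ⟨s, H⟩⟩
      have := Simulates.update ⟨hE, hT⟩ h₁ h₂ h₃ h₄ (.inr ⟨rfl, h₅⟩)
      rwa [← hc, Function.update_eq_self] at this
    -- Steps that pass a linearisation point
    have pass : ∀ {I' : Multiset ℤ} {st st' : List Frame} {x y : PMove} {C : Thread} {e' : Env},
        c = (st, .called x) → LinStep I st x I' y st' → EnvInv e' m₀ I' holder.isSome →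
        ThreadInv e' m₀ I' (holder = some k) (st', .lined y) C → Env.Extends ρ.env e' →
        (holder = some k ∨ I' = I ∧ e'.store fRef = ρ.env.store fRef) →
        ∃ σ' I' holder', Simulates ⟨Function.update ρ.threads k C, e'⟩ m₀ σ' I' holder' ∧
          ∀ A h s, AbsTrace σ' I' A h s → ∃ s', AbsTrace σ I A h s' := by
      intro I' st st' x y C e' h₀ hL h₁ h₂ h₃ h₄
      refine ⟨Function.update σ k (st', .lined y), I', holder, ?_, fun A h s H =>
        ⟨(⟨x, k + 1⟩, I) :: (⟨y, k + 1⟩, I') :: s, ?_⟩⟩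
      · exact Simulates.update ⟨hE, hT⟩ h₁ h₂ h₃ (by simp) h₄
      · exact .lin σ I A h s k st st' x y I' (hc.trans h₀) hL H
    cases hk with
    | active st _ m _ M₀ hloc hP =>
      obtain rfl | ⟨M₁, h₁, hloc⟩ := hloc.cases_head
      swap
      · obtain ⟨rfl, rfl, rfl⟩ := hM.eq_of_lstep h₁ hE.store_updR
        exact stay hE (.of_local hP hloc) (.refl _) (by simp) rfl
      obtain ⟨f, hf, hr⟩ := hE.store_f
      have hlock : ∀ v, Function.update ρ.env.store lockRef v fRef = ρ.env.store fRef :=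
        fun v => Function.update_of_ne (show fRef ≠ lockRef by decide) v _
      cases hP with
      | count i hh =>
        obtain ⟨r', rfl, hs⟩ := hM.rstep_of_decomp
          (E := .letIn 101 .hole (.app (.var 101) (.int i))) (r := .deref fRef) rfl
        cases hs with
        | deref _ v _ _ hv =>
          obtain rfl : v = .meth f := by simpa [hf] using hv.symm
          exact pass rfl (.count i I st) hE (.of_local (.countRet _ hh) (local_read hr i))
            (.refl _) (.inr ⟨rfl, rfl⟩)
      | countRet n hh =>
        obtain ⟨E, r, r', hd, -⟩ := hM.exists_rstep
        simp [decomp] at hd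
      | update i g hh hg =>
        obtain ⟨r', rfl, hs⟩ := hM.rstep_of_decomp
          (E := .app m₀ (.pairR (.int i) (.pairR (.meth g)
            (.letIn 101 .hole (.app (.var 101) (.int i)))))) (r := .deref fRef) rfl
        cases hs with
        | deref _ v _ _ hv =>
          obtain rfl : v = .meth f := by simpa [hf] using hv.symm
          have hty := (hE.absK g hg).1
          exact pass rfl (.update i g I st hty.1 hty.2) hE
            (.of_local (.call i g I hh hg) (((local_read hr i).fill
              (.app m₀ (.pairR (.int i) (.pairR (.meth g) .hole)))).trans
                (local_updR hE.repo_updR i _ g))) (.refl _) (.inr ⟨rfl, rfl⟩)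
      | call i g I₀ hh hg =>
        obtain ⟨r', rfl, hs⟩ := hM.rstep_of_decomp
          (E := callCtx i g (I₀.count i)) (r := .app (.meth g) (.int (I₀.count i))) rfl
        cases hs with
        | app _ _ _ _ _ _ _ hg' => simp [(hE.absK g hg).2] at hg'
      | acquire i j g I₀ hh hg =>
        obtain ⟨r', rfl, hs⟩ := hM.rstep_of_decomp
          (E := .letIn 100 .hole (lockedTerm i g (I₀.count i) (.int |j|)))
          (r := .acquire lockRef) rfl
        cases hs with
        | acquire _ _ _ hl =>
          have hnone : holder = none := by
            cases holder with
            | none => rfl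
            | some l => simp [hE.store_lock] at hl
          exact stay (holder' := some k) (hE.store_update_lock true)
            (.of_local (.locked i j g I₀ rfl hg) (.head rfl .refl)) (.refl _)
            (by simp [hnone, eq_comm]) (hlock (some (.int 1)))
      | locked i j g I₀ hh hg =>
        obtain ⟨r', rfl, hs⟩ := hM.rstep_of_decomp
          (E := .letIn vf .hole (branchTerm i g (I₀.count i) (.int |j|) (.var vf)))
          (r := .deref fRef) rfl
        cases hs with
        | deref _ v _ _ hv =>
          obtain rfl : v = .meth f := by simpa [hf] using hv.symm
          have hb := local_branch (m₀ := m₀) hr i (I₀.count i) |j| g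
          by_cases hi : I₀.count i = I.count i
          · rw [if_pos (by rw [hi])] at hb
            exact stay hE (.of_local (.closure i j g f I₀ hh hg hi hf) hb) (.refl _) (by simp) rfl
          · rw [if_neg (by exact_mod_cast hi)] at hb
            have hty := (hE.absK g hg).1
            exact pass rfl (.retry i j g I₀ I st hty.1 hty.2 hi) hE
              (.of_local (.releaseFail i g f I hh hg hr) hb) (.refl _) (.inl hh)
      | closure i j g m I₀ hh hg hi hm =>
        obtain ⟨r', rfl, hs⟩ := hM.rstep_of_decomp
          (E := .letIn 100 (.assign fRef .hole) (seq (.release lockRef) (.int |j|)))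
          (r := .lam vx .int
            (.ite (.op .eq (.var vx) (.int i)) (.int |j|) (.app (.meth m) (.var vx)))) rfl
        cases hs with
        | lam _ _ _ m' _ _ hm' =>
          obtain rfl : m = f := by simpa [hm] using hf
          have hx := extends_update (e := ρ.env) (m := m') ⟨vx,
            .ite (.op .eq (.var vx) (.int i)) (.int |j|) (.app (.meth m) (.var vx))⟩ hm'
          exact stay (hE.repo_insert _ hm' ((hnew m' hm' (by simp)).2 .K))
            (.of_local (.assign i j g m' I₀ hh hg hi
              (.override m' m i |j| _ (by simp) (hr.mono hx.1))) .refl) hx (by simp) rfl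
      | assign i j g m I₀ hh hg hi hm =>
        obtain ⟨r', rfl, hs⟩ := hM.rstep_of_decomp
          (E := .letIn 100 .hole (seq (.release lockRef) (.int |j|)))
          (r := .assign fRef (.meth m)) rfl
        cases hs with
        | assign _ _ v _ _ hv =>
          obtain rfl : v = .meth m := by simpa [Term.toVal?] using hv.symm
          have hty := (hE.absK g hg).1
          exact pass rfl (.done i j g I₀ I st hty.1 hty.2 hi)
            (hE.store_update_f (represents_setMult hm))
            (.of_local (.release |j| hh) (.head rfl .refl)) (.refl _) (.inl hh)
      | release y hh =>
        obtain ⟨r', rfl, hs⟩ := hM.rstep_of_decomp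
          (E := .letIn 100 .hole (.int y)) (r := .release lockRef) rfl
        cases hs with
        | assign _ _ v _ _ hv =>
          obtain rfl : v = .int 0 := by simpa [Term.toVal?] using hv.symm
          exact stay (holder' := none) (hE.store_update_lock false)
            (.of_local (.updateRet y (by simp)) (.head rfl .refl)) (.refl _)
            (by simp [hh, eq_comm]) (hlock (some (.int 0)))
      | updateRet n hh =>
        obtain ⟨E, r, r', hd, -⟩ := hM.exists_rstep
        simp [decomp] at hd
      | releaseFail i g m I₀ hh hg hm =>
        obtain ⟨r', rfl, hs⟩ := hM.rstep_of_decomp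
          (E := .letIn 100 .hole (callRef updRRef (.pair (.int i) (.pair (.meth g)
            (.app (.meth m) (.int i)))))) (r := .release lockRef) rfl
        cases hs with
        | assign _ _ v _ _ hv =>
          obtain rfl : v = .int 0 := by simpa [Term.toVal?] using hv.symm
          exact stay (holder' := none) (hE.store_update_lock false)
            (.of_local (.call i g I₀ (by simp) hg) (local_retry hm hE.repo_updR i g)) (.refl _)
            (by simp [hh, eq_comm]) (hlock (some (.int 0)))

theorem publish_int {e e' : Env} {Y : Side} {n : ℤ} {v' : Val}
    (h : Publish e Y (.int n) v' e') : v' = .int n ∧ e' = e := by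
  obtain ⟨τ, -, -, rfl, -, hr, hp, ha, hs⟩ := h
  refine ⟨rfl, ?_⟩
  obtain ⟨r, p, a, s⟩ := e
  obtain ⟨r', p', a', s'⟩ := e'
  simp only [Val.names, Set.image_empty, addNames, Set.union_empty,
    Function.update_eq_self] at hr hp ha hs
  simp [hp, ha, hs, funext fun n => hr n (by simp)]

theorem EnvInv.receive {e e' : Env} {m₀ : Meth} {I : Multiset ℤ} {b : Bool}
    (h : EnvInv e m₀ I b) {v : Val} (hv : ∀ m ∈ v.names, m.dom = .int ∧ m.cod = .int)
    (hr : Receive e .K v e') :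
    EnvInv e' m₀ I b ∧ Env.Extends e e' ∧ e'.store fRef = e.store fRef ∧
      e'.abs .K = e.abs .K ∪ v.names := by
  obtain ⟨hf, rfl⟩ := hr
  refine ⟨{ h with
    absL := by simpa [addNames] using h.absL
    absK := ?_ }, ⟨fun _ _ h => h, ?_⟩, rfl, by simp [addNames]⟩
  · intro m hm
    simp only [addNames, Function.update_self] at hm
    obtain hm | hm := hm
    · exact h.absK m hm
    · exact ⟨hv m hm, (hf m hm).2⟩
  · simp [addNames]

theorem EnvInv.eq_K_of_mem_pub {e : Env} {m₀ m : Meth} {I : Multiset ℤ} {b : Bool}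
    (h : EnvInv e m₀ I b) {Y : Side} (hm : m ∈ e.pub Y) : Y = .K ∧ m ∈ methods := by
  cases Y with
  | K => exact ⟨rfl, h.pubK ▸ hm⟩
  | L => simp [h.pubL] at hm

theorem EnvInv.eq_K_of_mem_abs {e : Env} {m₀ m : Meth} {I : Multiset ℤ} {b : Bool}
    (h : EnvInv e m₀ I b) {Y : Side} (hm : m ∈ e.abs Y) : Y = .K := by
  cases Y with
  | K => rfl
  | L => simp [h.absL] at hm

theorem exists_int_of_hasType {v : Val} (h : v.HasType .int) : ∃ i, v = .int i := by
  cases h with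
  | int i => exact ⟨i, rfl⟩

/-- An external step is matched by the abstract system. -/
theorem Simulates.ext {N : ℕ} {ρ : NConf N} {m₀ : Meth} {σ : Fin N → List Frame × Status}
    {I : Multiset ℤ} {holder : Option (Fin N)} (H : Simulates ρ m₀ σ I holder) {k : Fin N}
    {x : PMove} {C : Thread} {e : Env} (hstep : ExtStep (ρ.threads k) ρ.env x C e) :
    ∃ σ' I' holder',
      Simulates ⟨Function.update ρ.threads k C, e⟩ m₀ σ' I' holder' ∧
      ∀ h s, AbsTrace σ' I' (e.abs .K) h s →
        ∃ s', AbsTrace σ I (ρ.env.abs .K) (⟨x, k + 1⟩ :: h) s' := by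
  obtain ⟨hE, hT⟩ := H
  have hk := hT k
  generalize hc : σ k = c at hk
  -- Moves of the library
  have prop : ∀ {st : List Frame} {y : PMove} {C : Thread}, c = (st, .lined y) →
      y.act.val.names = ∅ → ThreadInv ρ.env m₀ I (holder = some k) (st, .idle) C →
      ∃ σ' I' holder', Simulates ⟨Function.update ρ.threads k C, ρ.env⟩ m₀ σ' I' holder' ∧
        ∀ h s, AbsTrace σ' I' (ρ.env.abs .K) h s →
          ∃ s', AbsTrace σ I (ρ.env.abs .K) (⟨y, k + 1⟩ :: h) s' := by
    intro st y C h₀ hy hC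
    refine ⟨Function.update σ k (st, .idle), I, holder, ?_, fun h s H => ⟨s, ?_⟩⟩
    · exact Simulates.update ⟨hE, hT⟩ hE hC (.refl _) (by simp) (.inr ⟨rfl, rfl⟩)
    · exact .prop σ I _ h s k st y (hc.trans h₀) hy H
  -- Moves of the environment
  have opp : ∀ {st : List Frame} {y : PMove} {C : Thread} {e : Env}, c = (st, .idle) →
      y.player = .O → (∀ m ∈ y.act.val.names, m.dom = .int ∧ m.cod = .int) →
      Receive ρ.env .K y.act.val e →
      (EnvInv e m₀ I holder.isSome → Env.Extends ρ.env e →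
        e.abs .K = ρ.env.abs .K ∪ y.act.val.names →
        ThreadInv e m₀ I (holder = some k) (st, .called y) C) →
      ∃ σ' I' holder', Simulates ⟨Function.update ρ.threads k C, e⟩ m₀ σ' I' holder' ∧
        ∀ h s, AbsTrace σ' I' (e.abs .K) h s →
          ∃ s', AbsTrace σ I (ρ.env.abs .K) (⟨y, k + 1⟩ :: h) s' := by
    intro st y C e h₀ hy hty hr hC
    obtain ⟨hE', hx, hf, ha⟩ := hE.receive hty hr
    refine ⟨Function.update σ k (st, .called y), I, holder, ?_, fun h s H => ⟨s, ?_⟩⟩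
    · exact Simulates.update ⟨hE, hT⟩ hE' (hC hE' hx ha) hx (by simp) (.inr ⟨rfl, hf⟩)
    · refine .opp σ I _ h s k st y (hc.trans h₀) hy (fun m hm => ?_) (ha ▸ H)
      have := (hr.1 m hm).1 .K
      exact ⟨this.2, hE.pubK ▸ this.1⟩
  generalize hCk : ρ.threads k = Ck at hk hstep
  cases hstep with
  | callP Y St E m v v' _ _ hm hv hpub =>
    obtain rfl := hE.eq_K_of_mem_abs hm
    have hd : decomp (E.fill (.app (.meth m) v.toTerm)) = some (E, .app (.meth m) v.toTerm) := by
      have : decomp (.app (.meth m) v.toTerm) = some (.hole, .app (.meth m) v.toTerm) := by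
        simp [decomp]
      simpa using decomp_fill this E
    cases hk with
    | active st _ m' _ M₀ hloc hP =>
      obtain rfl := hloc.eq_of_lstep_eq_none (by
        simp [lstep, hd, contract, (hE.absK m hm).2])
      generalize E.fill (.app (.meth m) v.toTerm) = M at hP hd
      cases hP with
      | call i g I₀ hh hg =>
        have hd' : decomp (callTerm i g (I₀.count i)) =
          some (callCtx i g (I₀.count i), .app (.meth g) (.int (I₀.count i))) := rfl
        rw [hd'] at hd
        simp only [Option.some.injEq, Prod.mk.injEq, Term.app.injEq, Term.meth.injEq] at hd
        obtain ⟨rfl, rfl, hv'⟩ := hd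
        obtain rfl : v = .int (I₀.count i) := by
          simpa [Term.toVal?] using (congrArg Term.toVal? hv').symm
        obtain ⟨rfl, rfl⟩ := publish_int hpub
        exact prop rfl rfl (.idle (⟨g, i, I₀⟩ :: st) hh)
      | count => cases hd
      | countRet => cases hd
      | update => cases hd
      | acquire => cases hd
      | locked => cases hd
      | closure => cases hd
      | assign => cases hd
      | release => cases hd
      | updateRet => cases hd
      | releaseFail => cases hd
  | retP Y St m v v' _ _ hm hv hpub =>
    obtain ⟨rfl, -⟩ := hE.eq_K_of_mem_pub hm
    have hd := decomp_toTerm v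
    generalize hM : v.toTerm = M at hk hd
    generalize hS : StackItem.meth m :: St = S at hk
    cases hk with
    | active st _ _ _ M₀ hloc hP =>
      obtain rfl := hloc.eq_of_lstep_eq_none (by simp [lstep, hd])
      obtain ⟨hm', rfl⟩ := List.cons.inj hS
      obtain rfl := StackItem.meth.inj hm'
      cases hP with
      | countRet n hh =>
        obtain rfl : v = .int n := by simpa [Term.toVal?] using congrArg Term.toVal? hM
        obtain ⟨rfl, rfl⟩ := publish_int hpub
        exact prop rfl rfl (.idle st hh)
      | updateRet y hh =>
        obtain rfl : v = .int y := by simpa [Term.toVal?] using congrArg Term.toVal? hM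
        obtain ⟨rfl, rfl⟩ := publish_int hpub
        exact prop rfl rfl (.idle st hh)
      | count => cases hd
      | call => cases hd
      | update => cases hd
      | acquire => cases hd
      | locked => cases hd
      | closure => cases hd
      | assign => cases hd
      | release => cases hd
      | releaseFail => cases hd
  | callO Y St m x M v _ _ hm hM hv hrec =>
    obtain ⟨rfl, hm'⟩ := hE.eq_K_of_mem_pub hm
    cases hk with
    | idle st hh =>
      obtain rfl | rfl := hm'
      · obtain ⟨i, rfl⟩ := exists_int_of_hasType hv
        obtain ⟨rfl, rfl⟩ : vi = x ∧ countBody = M := by simpa [hE.repo_count] using hM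
        exact opp rfl rfl (by simp [Action.val, Val.names]) hrec fun _ _ _ =>
          .of_local (.count i hh) (local_count i)
      · obtain ⟨rfl, rfl⟩ : vp = x ∧ updateBody = M := by simpa [hE.repo_update] using hM
        obtain ⟨i, g, rfl, hg⟩ : ∃ i g, v = .pair (.int i) (.meth g) ∧
            g.dom = .int ∧ g.cod = .int := by
          change v.HasType (.prod .int (.arr .int .int)) at hv
          cases hv with
          | pair h₁ h₂ =>
            obtain ⟨i, rfl⟩ := exists_int_of_hasType h₁
            rename_i w
            generalize hT : Ty.arr .int .int = T at h₂
            cases h₂ with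
            | meth g =>
              simp only [Ty.arr.injEq] at hT
              exact ⟨i, g, rfl, hT.1.symm, hT.2.symm⟩
            | _ => cases hT
        refine opp rfl rfl (by simpa [Action.val, Val.names] using hg) hrec fun hE' _ ha => ?_
        exact .active st _ _ _ _ (local_update i g)
          (.update i g hh (by rw [ha]; exact .inr (.inr rfl)))
  | retO Y St E m v _ _ hm hv hrec =>
    obtain rfl := hE.eq_K_of_mem_abs hm
    generalize hS : StackItem.meth m :: .ctx E :: St = S at hk
    cases hk with
    | idle st hh =>
      match st, hS with
      | ⟨g, i, I₀⟩ :: st, hS =>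
        simp only [stackOf, List.cons.injEq, StackItem.meth.injEq, StackItem.ctx.injEq] at hS
        obtain ⟨rfl, rfl, rfl⟩ := hS
        rw [(hE.absK m hm).1.2] at hv
        obtain ⟨j, rfl⟩ := exists_int_of_hasType hv
        exact opp rfl rfl (by simp [Action.val, Val.names]) hrec fun _ hx _ =>
          .of_local (.acquire i j m I₀ hh (hx.2 hm)) (local_abs i _ j m)

/-- Every complete run is matched by a complete abstract run. -/
theorem Simulates.trace {N : ℕ} {ρ ρ' : NConf N} {m₀ : Meth} {h : List Move}
    (hT : Trace ρ h ρ') (hF : ρ'.Final) :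
    ∀ {σ : Fin N → List Frame × Status} {I : Multiset ℤ} {holder : Option (Fin N)},
      Simulates ρ m₀ σ I holder → ∃ s, AbsTrace σ I (ρ.env.abs .K) h s := by
  induction hT with
  | refl ρ =>
    intro σ I holder H
    refine ⟨[], .nil σ I _ fun k => ?_⟩
    have hS := (hF k).1
    have hk := H.2 k
    generalize ρ.threads k = C at hk hS
    generalize σ k = c at hk ⊢
    cases hk with
    | idle st =>
      cases st with
      | nil => rfl
      | cons => cases hS
    | active => cases hS
  | int ρ ρ' h k C e hs _ _ ih =>
    intro σ I holder H
    obtain ⟨ha, σ', I', holder', H', hA⟩ := H.int hs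
    obtain ⟨s, hs⟩ := ih hF H'
    exact hA _ _ s (ha ▸ hs)
  | ext ρ ρ' h k x C e hs _ ih =>
    intro σ I holder H
    obtain ⟨σ', I', holder', H', hA⟩ := H.ext hs
    obtain ⟨s, hs⟩ := ih hF H'
    exact hA _ s hs

/-! ### Initial configurations and typing -/

theorem initConf_simulates {N : ℕ} {R : Repo} {S : Store} (h : lib.EvalsTo R S) :
    ∃ m₀, Simulates (initConf N ∅ methods R S) m₀ (fun _ => ([], .idle)) 0 none := by
  have hc : count ∈ lib.names := .inl rfl
  have hu : update ∈ lib.names := .inr (.inl rfl)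
  obtain h | ⟨_, h₁, h⟩ := h.cases_head
  · cases h
  cases h₁
  obtain h | ⟨_, h₁, h⟩ := h.cases_head
  · cases h
  cases h₁
  obtain h | ⟨_, h₁, h⟩ := h.cases_head
  · cases h
  cases h₁
  obtain h | ⟨_, h₁, h⟩ := h.cases_head
  · cases h
  obtain _ | _ | _ | _ | ⟨mF, _, _, _, _, _, _, _, _, hd₁, -, -, hF⟩ := h₁
  obtain h | ⟨_, h₁, h⟩ := h.cases_head
  · cases h
  obtain _ | _ | _ | ⟨_, _, _, _, _, _, -⟩ := h₁
  obtain h | ⟨_, h₁, h⟩ := h.cases_head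
  · cases h
  obtain _ | _ | _ | ⟨_, _, _, _, _, _, -⟩ := h₁
  obtain h | ⟨_, h₁, h⟩ := h.cases_head
  · cases h
  obtain _ | _ | _ | _ | ⟨mU, _, _, _, _, _, _, _, _, hd₂, -, hR, hU⟩ := h₁
  obtain h | ⟨_, h₁, h⟩ := h.cases_head
  swap
  · cases h₁
  cases h
  have h₁ : count ≠ mU := by rintro rfl; exact hU hc
  have h₂ : update ≠ mU := by rintro rfl; exact hU hu
  have h₃ : mF ≠ mU := by
    rintro rfl
    rw [hd₁] at hd₂
    cases hd₂
  have h₄ : mF ≠ count := by rintro rfl; exact hF hc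
  have h₅ : mF ≠ update := by rintro rfl; exact hF hu
  have h₆ : count ≠ update := by decide
  refine ⟨mU, ?_, fun k => .idle [] (by simp)⟩
  exact
    { pubK := rfl
      pubL := rfl
      absL := rfl
      absK := by simp [initConf]
      repo_count := by simp [initConf, h₁, h₆]
      repo_update := by simp [initConf, h₂]
      repo_updR := by simp [initConf]
      store_updR := by simp [initConf, updRRef]
      store_f := ⟨mF, by simp [initConf, fRef, updRDom],
        by simpa using Represents.zero mF (by simp [initConf, h₃, h₄, h₅])⟩
      store_lock := by simp [initConf, lockRef] }

theorem genLinearises : GenLinearises ∅ methods lib spec := by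
  rintro N hN h ⟨R, S, hL, ρ, hT, hF⟩
  obtain ⟨m₀, H⟩ := initConf_simulates (N := N) hL
  obtain ⟨s, hs⟩ := H.trace hT hF
  exact hs.exists_spec hN

theorem callRef_hasType {Γ : Ctx} {r : Ref} {M : Term} {a b : Ty} (hr : r.ty = .arr a b)
    (hM : Term.HasType (Γ.extend 101 (.arr a b)) M a) : Term.HasType Γ (callRef r M) b :=
  .letIn (hr ▸ .deref r) (.appVar (by simp [Ctx.extend]) hM)

theorem seq_hasType {Γ : Ctx} {M N : Term} {b : Ty} (hM : Term.HasType Γ M .unit)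
    (hN : Term.HasType (Γ.extend 100 .unit) N b) : Term.HasType Γ (seq M N) b :=
  .letIn hM hN

theorem countBody_hasType : Term.HasType (Ctx.empty.extend vi .int) countBody .int :=
  callRef_hasType rfl (.var rfl)

theorem updateBody_hasType :
    Term.HasType (Ctx.empty.extend vp (.prod .int (.arr .int .int))) updateBody .int :=
  .letIn (.fst (.var rfl)) <| .letIn (.snd (.var rfl)) <| callRef_hasType rfl <|
    .pair (.var rfl) (.pair (.var rfl) (callRef_hasType rfl (.var rfl)))

theorem updRBody_hasType : Term.HasType (Ctx.empty.extend vp updRDom) updRBody .int := by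
  refine .letIn (.fst (.var rfl)) <| .letIn (.fst (.snd (.var rfl))) <|
    .letIn (.snd (.snd (.var rfl))) <| .letIn (a := .int) ?_ <| seq_hasType (.acquire 0) <|
    .letIn (.deref fRef) <| .ite (.op _ (.var rfl) (.appVar rfl (.var rfl)))
      (seq_hasType (.assign fRef (.lam ?_))
        (seq_hasType (.assign lockRef (.int 0)) (.var rfl)))
      (seq_hasType (.assign lockRef (.int 0)) <| callRef_hasType rfl <|
        .pair (.var rfl) (.pair (.var rfl) (.appVar rfl (.var rfl))))
  · exact .letIn (.appVar rfl (.var rfl)) (.ite (.op _ (.var rfl) (.int 0))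
      (.op _ (.int 0) (.var rfl)) (.var rfl))
  · exact .ite (.op _ (.var rfl) (.var rfl)) (.var rfl) (.appVar rfl (.var rfl))

theorem lib_hasType : lib.HasType ∅ ∅ methods := by
  have hne : count ∉ ({update} : Set Meth) := by
    rw [Set.mem_singleton_iff]
    decide
  have hB : Block.HasType (.initInt 0 0 <| .initFn .int .int 0 vx (.int 0) <|
      .defMeth count vi countBody <| .defMeth update vp updateBody <|
      .initFn updRDom .int 0 vp updRBody .nil) methods := by
    refine .initInt (.initFn (.int 0) ?_)
    have h : Block.HasType (.defMeth update vp updateBody <|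
        .initFn updRDom .int 0 vp updRBody .nil) {update} := by
      rw [← insert_empty_eq]
      exact .defMeth updateBody_hasType (.initFn updRBody_hasType .nil) (by simp)
    exact .defMeth countBody_hasType h hne
  refine .pub (by simp) (.pub ?_ ?_ (.inr rfl)) (.inl rfl)
  · rw [insert_empty_eq, Set.mem_singleton_iff]
    decide
  · convert Library.HasType.block hB using 1
    simp [Block.names, countBody, updateBody, updRBody, callRef, seq, absTerm, Term.names,
      Term.release]

end MSet

end HOLin

theorem mainTheorem9 :
    HOLin.Library.HasType ∅ HOLin.MSet.lib ∅ HOLin.MSet.methods ∧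
    HOLin.MSet.spec ⊆ HOLin.SeqHist ∅ HOLin.MSet.methods ∧
    HOLin.GenLinearises ∅ HOLin.MSet.methods HOLin.MSet.lib HOLin.MSet.spec :=
  ⟨HOLin.MSet.lib_hasType, fun _ ⟨_, hs, e⟩ => e ▸ hs.1, HOLin.MSet.genLinearises⟩
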